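/- Let $V$ be a finite set. A directed acyclic hypergraph (HDAG) $\mathcal H=(V,H)$ is a set $H$ of hyperedges $(S,j)$ with $j\in V$, $S\subseteq V\setminus\{j\}$, which is hierarchical ($(\emptyset,j)\in H$ for every $j$, and $(S,j)\in H$, $T\subseteq S$ imply $(T,j)\in H$) and such that the directed graph with an edge $k\to j$ whenever $(\{k\},j)\in H$ ("$k$ is a parent of $j$", $k\in\mathrm{Pa}(j)$) is acyclic. Its *body* is the undirected hypergraph with hyperedges $\{S\cup\{j\}:(S,j)\in H\}$. A *multi-collider* is a pair $(S,j)$ with $|S|\ge 2$ such that every $s\in S$ is a parent of $j$; it is *unshielded* if $(S\setminus\{t\},t)\notin H$ for all $t\in S$. Let $X_i$ ($i\in V$) be discrete variables with finite state spaces $\Omega_i$, $|\Omega_i|\ge2$, and let $p$ range over the strictly positive distributions on $\prod_i\Omega_i$. Such a $p$ is *Markov* to $\mathcal H$ if there are functions $\theta_{i,S}$ with $$\log p(x)=\sum_{i\in V}\Big(\sum_{S:(S,i)\in H}\theta_{i,S}(x_i;x_S)-\mathcal Z_i(x_{\mathrm{Pa}(i)})\Big),\qquad \mathcal Z_i(x_{\mathrm{Pa}(i)})=\log\sum_{a\in\Omega_i}\exp\sum_{S:(S,i)\in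 H}\theta_{i,S}(a;x_S).$$ For disjoint $T,Z\subseteq V$ with $|T|\ge2$, the variables $X_T$ are *conditionally multi-independent* given $X_Z$ if $\log p(x_T\mid x_Z)=\sum_{t\in T}\theta_t(x_{T\setminus\{t\}};x_Z)+c(x_Z)$ for some functions $\theta_t$, $c$. The HDAG $\mathcal H$ *induces* this statement if it holds for every strictly positive $p$ (on the given state spaces) that is Markov to $\mathcal H$; and $p$ is *faithful* to $\mathcal H$ if it satisfies only conditional multi-independences that are induced by $\mathcal H$. A set $T$ is *inseparable* in $p$ if $X_T$ is not conditionally multi-independent given $X_Z$ for any $Z$ disjoint from $T$. **Theorem 1.** 1. Two HDAGs on $V$ induce the same conditional multi-independences (they are *hyper Markov equivalent*) if and only if they have the same body and the same unshielded multi-colliders. 2. The HDAG is identifiable up to its hyper Markov equivalence class: if $p$ is Markov and faithful to $\mathcal H_1$, then for every HDAG $\mathcal H_2$ on $V$, $p$ is Markov and faithful to $\mathcal H_2$ if and only if $\mathcal H_1$ and $\mathcal H_2$ have the same body and the same unshielded multi-colliders. 3. The class is read off from the conditional multi-independences of $p$: if $p$ is Markov and faithful to $\mathcal H$, then a set $T$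 with $|T|\ge2$ is a hyperedge of the body of $\mathcal H$ if and only if $T$ is inseparable in $p$; and for $|T|\ge 2$ and $j\notin T$, $(T,j)$ is an unshielded multi-collider of $\mathcal H$ if and only if $\{t,j\}$ is inseparable in $p$ for every $t\in T$ and there is a set $Z$, disjoint from $T\cup\{j\}$, such that $X_T$ is conditionally multi-independent given $X_Z$ but not given $X_{Z\cup\{j\}}$. -/

import Mathlib

/-- A directed acyclic hypergraph (HDAG) on the vertex set `V`: `H.hyperparents j` is the set of all
`S` such that `(S, j)` is a directed hyperedge.  The hyperedge set is hierarchical (for every `j`,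
the hyperparents of `j` form a simplicial complex; it contains `∅`, the intercept term of `j`), and
the underlying directed graph, with `k → j` iff `({k}, j)` is a hyperedge, has no directed cycle. -/
structure HDAG (V : Type*) [DecidableEq V] where
  hyperparents : V → Finset (Finset V)
  empty_mem : ∀ j, ∅ ∈ hyperparents j
  notMem_of_mem : ∀ j, ∀ S ∈ hyperparents j, j ∉ S
  mem_of_subset : ∀ j, ∀ S ∈ hyperparents j, ∀ T, T ⊆ S → T ∈ hyperparents j
  acyclic : ∀ v, ¬ Relation.TransGen (fun k j => ({k} : Finset V) ∈ hyperparents j) v v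

/-- `k` is a parent of `j`.  By hierarchy this says that `k` lies in some hyperparent of `j`. -/
def HDAG.IsParent {V : Type*} [DecidableEq V] (H : HDAG V) (k j : V) : Prop :=
  ({k} : Finset V) ∈ H.hyperparents j

/-- The body: the undirected hypergraph obtained by forgetting the orientations. -/
def HDAG.body {V : Type*} [DecidableEq V] (H : HDAG V) : Set (Finset V) :=
  {U | ∃ (S : Finset V) (j : V), S ∈ H.hyperparents j ∧ U = insert j S}

/-- `(S, j)` is a multi-collider (of order `|S| ≥ 2`): every element of `S` is a parent of `j`.
It is not required that `S` itself is a hyperparent of `j`. -/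
def HDAG.IsMultiCollider {V : Type*} [DecidableEq V] (H : HDAG V) (S : Finset V) (j : V) : Prop :=
  2 ≤ S.card ∧ ∀ s ∈ S, H.IsParent s j

/-- A multi-collider `(S, j)` is unshielded if no hyperedge jointly connects `S`. -/
def HDAG.IsUnshieldedMultiCollider {V : Type*} [DecidableEq V] (H : HDAG V)
    (S : Finset V) (j : V) : Prop :=
  H.IsMultiCollider S j ∧ ∀ t ∈ S, S.erase t ∉ H.hyperparents t

/-- A strictly positive probability distribution of finitely many discrete variables `X_i`,
`i ∈ V`, where `X_i` takes values in `Ω i`. -/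
structure PosDist {V : Type*} [Fintype V] [DecidableEq V] (Ω : V → Type*)
    [∀ i, Fintype (Ω i)] where
  mass : (∀ i, Ω i) → ℝ
  pos : ∀ x, 0 < mass x
  sum_eq_one : ∑ x, mass x = 1

open Classical in
/-- The marginal probability `p(x_A)`, written as a function of a full configuration `x`. -/
noncomputable def PosDist.marginal {V : Type*} [Fintype V] [DecidableEq V] {Ω : V → Type*}
    [∀ i, Fintype (Ω i)] (p : PosDist Ω) (A : Finset V) (x : ∀ i, Ω i) : ℝ :=
  ∑ y with (∀ i ∈ A, y i = x i), p.mass y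

/-- Conditional multi-independence of the variables in `T` given the variables in `Z`:
`log p(x_T | x_Z) = ∑_{t ∈ T} θ_t(x_{T - t}; x_Z) + c(x_Z)` for some functions `θ_t` and `c`,
that is, `log p(x_T | x_Z)` can be written without an energy term of the full order `|T|`.
For `|T| = 2` this is conditional independence. -/
def PosDist.MultiIndep {V : Type*} [Fintype V] [DecidableEq V] {Ω : V → Type*}
    [∀ i, Fintype (Ω i)] (p : PosDist Ω) (T Z : Finset V) : Prop :=
  ∃ (θ : V → (∀ i, Ω i) → ℝ) (c : (∀ i, Ω i) → ℝ),
    (∀ t ∈ T, DependsOn (θ t) (↑(T.erase t ∪ Z) : Set V)) ∧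
    DependsOn c (↑Z : Set V) ∧
    ∀ x, Real.log (p.marginal (T ∪ Z) x / p.marginal Z x) = ∑ t ∈ T, θ t x + c x

/-- The directed hyper-Markov property:
`log p(x) = ∑_i (∑_{S ∈ HypPa(i)} θ_{i,S}(x_i; x_S) - 𝒵_i(x_{Pa(i)}))`, where `𝒵_i` is the
log-normalizer of the `i`-th conditional distribution. -/
def PosDist.IsMarkov {V : Type*} [Fintype V] [DecidableEq V] {Ω : V → Type*}
    [∀ i, Fintype (Ω i)] (p : PosDist Ω) (H : HDAG V) : Prop :=
  ∃ θ : V → Finset V → (∀ i, Ω i) → ℝ,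
    (∀ i, ∀ S ∈ H.hyperparents i, DependsOn (θ i S) (↑(insert i S) : Set V)) ∧
    ∀ x, Real.log (p.mass x) =
      ∑ i, ((∑ S ∈ H.hyperparents i, θ i S x) -
        Real.log (∑ a : Ω i,
          Real.exp (∑ S ∈ H.hyperparents i, θ i S (Function.update x i a))))

/-- The HDAG `H` induces the conditional multi-independence of `T` given `Z` (for variables with
state spaces `Ω`): it holds in every strictly positive distribution that is Markov to `H`. -/
def HDAG.Induces {V : Type*} [Fintype V] [DecidableEq V] (H : HDAG V) (Ω : V → Type*)
    [∀ i, Fintype (Ω i)] (T Z : Finset V) : Prop :=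
  ∀ p : PosDist Ω, p.IsMarkov H → p.MultiIndep T Z

/-- `p` is faithful to `H`: `p` satisfies no conditional multi-independence besides those induced
by `H`, i.e. no energy term that the structure of `H` allows after marginalizing and conditioning
is cancelled accidentally. -/
def PosDist.IsFaithful {V : Type*} [Fintype V] [DecidableEq V] {Ω : V → Type*}
    [∀ i, Fintype (Ω i)] (p : PosDist Ω) (H : HDAG V) : Prop :=
  ∀ T Z : Finset V, 2 ≤ T.card → Disjoint T Z → p.MultiIndep T Z → H.Induces Ω T Z

/-- Same induced conditional multi-independences, the definition of hyper Markov equivalence. -/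
def HDAG.HyperMarkovEquiv {V : Type*} [Fintype V] [DecidableEq V] (Ω : V → Type*)
    [∀ i, Fintype (Ω i)] (H₁ H₂ : HDAG V) : Prop :=
  ∀ T Z : Finset V, 2 ≤ T.card → Disjoint T Z → (H₁.Induces Ω T Z ↔ H₂.Induces Ω T Z)

/-- Same body and same unshielded multi-colliders. -/
def HDAG.SameBodyAndColliders {V : Type*} [DecidableEq V] (H₁ H₂ : HDAG V) : Prop :=
  H₁.body = H₂.body ∧
    ∀ S j, H₁.IsUnshieldedMultiCollider S j ↔ H₂.IsUnshieldedMultiCollider S j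

/-- The variables in `T` are inseparable in `p`: they are not conditionally multi-independent for
any conditioning set. -/
def PosDist.Inseparable {V : Type*} [Fintype V] [DecidableEq V] {Ω : V → Type*}
    [∀ i, Fintype (Ω i)] (p : PosDist Ω) (T : Finset V) : Prop :=
  ∀ Z : Finset V, Disjoint T Z → ¬ p.MultiIndep T Z

/-!
A distribution is Markov to `H` exactly if it is a product of conditional distributions of `x_i`
given the parents of `i` whose logarithms lie in `H.energySpace Ω i`, up to functions of the parents
(`PosDist.isMarkov_iff_exists_log_kernel`). Everything is read off from this product form.

*Same body and same unshielded multi-colliders imply the same Markov distributions.* As in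
Chickering's proof of the Verma-Pearl theorem, one passes from the first HDAG to the second by
reversing covered edges (`HDAG.SameBodyAndColliders.induction`). For hypergraphs, an edge `x → y` is
covered if `y` has the parents of `x` and `x` as its parents and the set of parents of `x` is a
hyperparent of both `x` and `y`. Then Bayes' rule re-splits the product of the two conditional
distributions without creating a forbidden energy (`PosDist.IsMarkov.reverse`).

*The body and the unshielded multi-colliders are determined by the induced multi-independences.*
A set `T` is a member of the body if and only if no multi-independence of `T` is induced. If `T` is
not a member, then it is multi-independent given the other vertices before its last element: the
marginal on this ancestral set is a product of kernels, none of which has an energy that involves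
all of `T` (`HDAG.exists_induces_of_notMem_body`). If it is a member, then a single energy on `T`
is a counterexample for each conditioning set (`HDAG.not_induces_of_mem_body`).
If all elements of `T` are adjacent to `j`, then two kinds of stars with pair interactions tell
whether `j` is a collider: if `T` consists of parents of `j`, then the log-normalizer of `j` makes
`T` dependent given `j` (`HDAG.not_induces_insert_of_parents`), and if `j` has a child in `T`, then
summing over `x_j` makes `T` dependent without conditioning on `j` (`HDAG.not_induces_of_child`).

Dependence of full order is detected by the alternating sum of the log-density over the vertices
of a cube of configurations (`altSum`); for the stars it is computed in the limit in which the
pair interactions forbid the joint states.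
-/

/-! ### Directed acyclic hypergraphs -/

namespace HDAG

variable {V : Type*} [DecidableEq V]

theorem exists_rank [Fintype V] (H : HDAG V) : ∃ r : V → ℕ, ∀ k j, H.IsParent k j → r k < r j := by
  classical
  refine ⟨fun v => (Finset.univ.filter fun u => Relation.TransGen H.IsParent u v).card, ?_⟩
  intro k j hkj
  apply Finset.card_lt_card
  rw [Finset.ssubset_iff_of_subset]
  · refine ⟨k, ?_, ?_⟩
    · simpa using Relation.TransGen.single hkj
    · exact fun hk => H.acyclic k (Finset.mem_filter.1 hk).2
  · intro u hu
    simp only [Finset.mem_filter, Finset.mem_univ, true_and] at hu ⊢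
    exact hu.tail hkj

/-- The set of parents of `j`, as a finset. -/
def parents [Fintype V] (H : HDAG V) (j : V) : Finset V :=
  Finset.univ.filter fun k => ({k} : Finset V) ∈ H.hyperparents j

theorem mem_parents [Fintype V] {H : HDAG V} {k j : V} : k ∈ H.parents j ↔ H.IsParent k j := by
  simp [parents, IsParent]

theorem isParent_of_mem {H : HDAG V} {S : Finset V} {j k : V} (hS : S ∈ H.hyperparents j)
    (hk : k ∈ S) : H.IsParent k j :=
  H.mem_of_subset j S hS _ (by simpa using hk)

theorem subset_parents [Fintype V] {H : HDAG V} {S : Finset V} {j : V}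
    (hS : S ∈ H.hyperparents j) : S ⊆ H.parents j :=
  fun _ hk => mem_parents.2 (isParent_of_mem hS hk)

theorem IsParent.ne {H : HDAG V} {k j : V} (h : H.IsParent k j) : k ≠ j := by
  rintro rfl
  exact H.notMem_of_mem k _ h (by simp)

theorem insert_mem_body {H : HDAG V} {S : Finset V} {j : V} (hS : S ∈ H.hyperparents j) :
    insert j S ∈ H.body := ⟨S, j, hS, rfl⟩

theorem singleton_mem_body (H : HDAG V) (j : V) : {j} ∈ H.body :=
  ⟨∅, j, H.empty_mem j, by simp⟩

/-- A member of the body contains an element of which all the others form a hyperparent. -/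
theorem mem_body_iff {H : HDAG V} {U : Finset V} :
    U ∈ H.body ↔ ∃ j ∈ U, U.erase j ∈ H.hyperparents j := by
  constructor
  · rintro ⟨S, j, hS, rfl⟩
    refine ⟨j, by simp, ?_⟩
    rwa [Finset.erase_insert (H.notMem_of_mem j S hS)]
  · rintro ⟨j, hj, h⟩
    exact ⟨_, j, h, (Finset.insert_erase hj).symm⟩

theorem isUnshieldedMultiCollider_iff {H : HDAG V} {S : Finset V} {j : V} :
    H.IsUnshieldedMultiCollider S j ↔ 2 ≤ S.card ∧ (∀ s ∈ S, H.IsParent s j) ∧ S ∉ H.body := by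
  simp only [IsUnshieldedMultiCollider, IsMultiCollider, mem_body_iff, not_exists, not_and,
    and_assoc]

theorem pair_mem_body_iff {H : HDAG V} {a b : V} (hab : a ≠ b) :
    {a, b} ∈ H.body ↔ H.IsParent a b ∨ H.IsParent b a := by
  rw [mem_body_iff]
  have h1 : ({a, b} : Finset V).erase a = {b} := by
    ext x; simp only [Finset.mem_erase, Finset.mem_insert, Finset.mem_singleton]; grind
  have h2 : ({a, b} : Finset V).erase b = {a} := by
    ext x; simp only [Finset.mem_erase, Finset.mem_insert, Finset.mem_singleton]; grind
  simp [h1, h2, IsParent, or_comm]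

theorem IsParent.asymm [Fintype V] {H : HDAG V} {a b : V} (h : H.IsParent a b) :
    ¬ H.IsParent b a := by
  obtain ⟨r, hr⟩ := H.exists_rank
  intro h'
  have := hr _ _ h
  have := hr _ _ h'
  omega

/-- The body and the parents determine the hyperparents. -/
theorem mem_hyperparents_of_insert_mem_body [Fintype V] {H : HDAG V} {S : Finset V} {j : V}
    (hj : j ∉ S) (hS : ∀ s ∈ S, H.IsParent s j) (h : insert j S ∈ H.body) :
    S ∈ H.hyperparents j := by
  obtain ⟨i, hi, h⟩ := mem_body_iff.1 h
  rcases Finset.mem_insert.1 hi with rfl | hi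
  · rwa [Finset.erase_insert hj] at h
  · have hij : j ≠ i := fun e => hj (e ▸ hi)
    exact absurd (isParent_of_mem h (k := j) (by simp [hij])) (hS i hi).asymm

/-- The edge `x → y` is covered: `y` has the parents of `x` and `x` itself as its parents, and the
parents of `x` are jointly hyperparents of both `x` and `y`.  Such an edge can be reversed. -/
structure IsCovered [Fintype V] (H : HDAG V) (x y : V) : Prop where
  isParent : H.IsParent x y
  parents_eq : H.parents y = insert x (H.parents x)
  parents_mem_left : H.parents x ∈ H.hyperparents x
  parents_mem_right : H.parents x ∈ H.hyperparents y

/-! ### Reversal of covered edges -/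

section Reverse

variable [Fintype V] {H : HDAG V} {x y : V}

theorem IsCovered.ne (h : H.IsCovered x y) : x ≠ y := h.isParent.ne

theorem IsCovered.notMem (h : H.IsCovered x y) : y ∉ H.parents x :=
  fun h' => h.isParent.asymm (mem_parents.1 h')

theorem notMem_parents (H : HDAG V) (j : V) : j ∉ H.parents j :=
  fun h => (mem_parents.1 h).ne rfl

/-- The hyperparents after the reversal of the covered edge `x → y`: every hyperedge
`(S ∪ {x}, y)` becomes `(S ∪ {y}, x)`. -/
def reverseHyperparents (H : HDAG V) (x y j : V) : Finset (Finset V) :=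
  if j = y then (H.parents x).powerset
  else if j = x then Finset.univ.filter fun S =>
    x ∉ S ∧ (S ⊆ H.parents x ∨ y ∈ S ∧ insert x (S.erase y) ∈ H.hyperparents y)
  else H.hyperparents j

theorem mem_reverse_right {S : Finset V} :
    S ∈ H.reverseHyperparents x y y ↔ S ⊆ H.parents x := by
  simp [reverseHyperparents]

theorem mem_reverse_left (hxy : x ≠ y) {S : Finset V} :
    S ∈ H.reverseHyperparents x y x ↔
      x ∉ S ∧ (S ⊆ H.parents x ∨ y ∈ S ∧ insert x (S.erase y) ∈ H.hyperparents y) := by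
  simp [reverseHyperparents, hxy]

theorem mem_reverse_of_ne {j : V} (hx : j ≠ x) (hy : j ≠ y) :
    H.reverseHyperparents x y j = H.hyperparents j := by
  simp [reverseHyperparents, hx, hy]

theorem IsCovered.singleton_mem_reverse_iff (h : H.IsCovered x y) {k j : V} :
    {k} ∈ H.reverseHyperparents x y j ↔
      (H.IsParent k j ∧ ¬ (k = x ∧ j = y)) ∨ (k = y ∧ j = x) := by
  have hne := h.ne
  have hpar := @mem_parents _ _ _ H
  have h1 := h.notMem
  have hx := H.notMem_parents x
  by_cases hjy : j = y
  · subst hjy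
    rw [mem_reverse_right, Finset.singleton_subset_iff, ← hpar, h.parents_eq]
    grind
  by_cases hjx : j = x
  · subst hjx
    rw [mem_reverse_left hne, Finset.singleton_subset_iff, ← hpar]
    have : y ∈ ({k} : Finset V) ∧ insert j (({k} : Finset V).erase y) ∈ H.hyperparents y ↔
        k = y := by
      constructor
      · intro h; have := h.1; simp at this; exact this.symm
      · rintro rfl; exact ⟨by simp, by simpa [IsParent] using h.isParent⟩
    rw [this]
    grind
  · rw [mem_reverse_of_ne hjx hjy]
    simp [hjx, hjy, IsParent]

/-- The reversal of a covered edge. -/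
def reverse (H : HDAG V) (x y : V) (h : H.IsCovered x y) : HDAG V where
  hyperparents := H.reverseHyperparents x y
  empty_mem j := by
    unfold reverseHyperparents
    split_ifs <;> simp [H.empty_mem]
  notMem_of_mem j S hS := by
    unfold reverseHyperparents at hS
    split_ifs at hS with h1 h2
    · subst h1
      exact fun hj => h.notMem (Finset.mem_powerset.1 hS hj)
    · subst h2
      exact (Finset.mem_filter.1 hS).2.1
    · exact H.notMem_of_mem j S hS
  mem_of_subset j S hS T hT := by
    unfold reverseHyperparents at hS ⊢
    split_ifs at hS ⊢ with h1 h2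
    · exact Finset.mem_powerset.2 (hT.trans (Finset.mem_powerset.1 hS))
    · simp only [Finset.mem_filter, Finset.mem_univ, true_and] at hS ⊢
      obtain ⟨hx, hS⟩ := hS
      refine ⟨fun h => hx (hT h), ?_⟩
      rcases hS with hS | ⟨hy, hS⟩
      · exact Or.inl (hT.trans hS)
      · by_cases hyT : y ∈ T
        · exact Or.inr ⟨hyT, H.mem_of_subset _ _ hS _
            (Finset.insert_subset_insert _ (Finset.erase_subset_erase _ hT))⟩
        · left
          intro s hs
          have hsub := subset_parents hS
          rw [h.parents_eq] at hsub
          have h1 : s ≠ x := fun e => hx (e ▸ hT hs)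
          have h2 : s ≠ y := fun e => hyT (e ▸ hs)
          have := hsub (Finset.mem_insert_of_mem (Finset.mem_erase.2 ⟨h2, hT hs⟩))
          exact (Finset.mem_insert.1 this).resolve_left h1
    · exact H.mem_of_subset j S hS T hT
  acyclic v hv := by
    obtain ⟨r, hr⟩ := H.exists_rank
    -- In a topological order, `y` is moved to the place immediately before `x`.
    let r' : V → ℕ := fun v => if v = y then 2 * r x else 2 * r v + 1
    have hr' : ∀ k j, ({k} : Finset V) ∈ H.reverseHyperparents x y j → r' k < r' j := by
      intro k j hkj
      have hxy := hr _ _ h.isParent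
      rcases h.singleton_mem_reverse_iff.1 hkj with ⟨hp, hn⟩ | ⟨rfl, rfl⟩
      · have hkj := hr _ _ hp
        by_cases hjy : j = y
        · subst hjy
          have hk : k ∈ H.parents j := mem_parents.2 hp
          rw [h.parents_eq, Finset.mem_insert] at hk
          have hk := hr _ _ (mem_parents.1 (hk.resolve_left (by tauto)))
          have : k ≠ j := hp.ne
          simp only [r', if_neg this, if_true]
          omega
        · by_cases hky : k = y
          · subst hky
            simp only [r', if_neg hjy, if_true]
            omega
          · simp only [r', if_neg hjy, if_neg hky]
            omega
      · simp only [r', if_true, if_neg h.ne]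
        omega
    have key : ∀ a b, Relation.TransGen
        (fun k j => ({k} : Finset V) ∈ H.reverseHyperparents x y j) a b → r' a < r' b := by
      intro a b hab
      induction hab with
      | single h => exact hr' _ _ h
      | tail _ h ih => exact ih.trans (hr' _ _ h)
    exact lt_irrefl _ (key v v hv)

theorem reverse_isParent_iff (h : H.IsCovered x y) {k j : V} :
    (H.reverse x y h).IsParent k j ↔
      (H.IsParent k j ∧ ¬ (k = x ∧ j = y)) ∨ (k = y ∧ j = x) :=
  h.singleton_mem_reverse_iff

theorem reverse_parents_left (h : H.IsCovered x y) :
    (H.reverse x y h).parents x = insert y (H.parents x) := by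
  ext k
  rw [mem_parents, reverse_isParent_iff, Finset.mem_insert, mem_parents]
  have := h.ne
  tauto

theorem reverse_body (h : H.IsCovered x y) : (H.reverse x y h).body = H.body := by
  have hxy := h.ne
  ext U
  constructor
  · rintro ⟨S, j, hS, rfl⟩
    change S ∈ H.reverseHyperparents x y j at hS
    by_cases hjy : j = y
    · subst hjy
      rw [mem_reverse_right] at hS
      exact insert_mem_body (H.mem_of_subset _ _ h.parents_mem_right _ hS)
    by_cases hjx : j = x
    · subst hjx
      rw [mem_reverse_left hxy] at hS
      rcases hS with ⟨hj, hS | ⟨hy, hS⟩⟩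
      · exact insert_mem_body (H.mem_of_subset _ _ h.parents_mem_left _ hS)
      · have := insert_mem_body hS
        rwa [Finset.insert_comm, Finset.insert_erase hy] at this
    · rw [mem_reverse_of_ne hjx hjy] at hS
      exact insert_mem_body hS
  · rintro ⟨S, j, hS, rfl⟩
    by_cases hjy : j = y
    · subst hjy
      have hsub := subset_parents hS
      have hjS := H.notMem_of_mem j S hS
      rw [h.parents_eq] at hsub
      by_cases hxS : x ∈ S
      · refine ⟨insert j (S.erase x), x, ?_, ?_⟩
        · change _ ∈ H.reverseHyperparents x j x
          rw [mem_reverse_left hxy]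
          refine ⟨by simp [hxy], Or.inr ⟨by simp, ?_⟩⟩
          rwa [Finset.erase_insert (by simp [hjS]), Finset.insert_erase hxS]
        · rw [Finset.insert_comm, Finset.insert_erase hxS]
      · refine ⟨S, j, ?_, rfl⟩
        change _ ∈ H.reverseHyperparents x j j
        rw [mem_reverse_right]
        exact (Finset.subset_insert_iff_of_notMem hxS).1 hsub
    by_cases hjx : j = x
    · subst hjx
      refine ⟨S, j, ?_, rfl⟩
      change _ ∈ H.reverseHyperparents j y j
      rw [mem_reverse_left hxy]
      exact ⟨H.notMem_of_mem j S hS, Or.inl (subset_parents hS)⟩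
    · refine ⟨S, j, ?_, rfl⟩
      change _ ∈ H.reverseHyperparents x y j
      rwa [mem_reverse_of_ne hjx hjy]

theorem sameBodyAndColliders_reverse (h : H.IsCovered x y) :
    SameBodyAndColliders (H.reverse x y h) H := by
  refine ⟨reverse_body h, fun S j => ?_⟩
  rw [isUnshieldedMultiCollider_iff, isUnshieldedMultiCollider_iff, reverse_body h]
  refine and_congr_right fun _ => and_congr_left fun hS => ?_
  have hxy := h.ne
  -- A collider at `y` through `x` (or, after the reversal, at `x` through `y`) has its other
  -- vertices among the parents of `x`, hence is shielded.
  constructor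
  · intro hpar s hs
    rcases reverse_isParent_iff h |>.1 (hpar s hs) with h1 | ⟨rfl, rfl⟩
    · exact h1.1
    · refine absurd (mem_body_iff.2 ⟨s, hs, ?_⟩) hS
      refine H.mem_of_subset _ _ h.parents_mem_right _ fun t ht => ?_
      rw [Finset.mem_erase] at ht
      have := mem_parents.2 (hpar t ht.2)
      rw [reverse_parents_left] at this
      exact (Finset.mem_insert.1 this).resolve_left ht.1
  · intro hpar s hs
    refine (reverse_isParent_iff h).2 (Or.inl ⟨hpar s hs, ?_⟩)
    rintro ⟨rfl, rfl⟩
    refine hS (mem_body_iff.2 ⟨s, hs, ?_⟩)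
    refine H.mem_of_subset _ _ h.parents_mem_left _ fun t ht => ?_
    rw [Finset.mem_erase] at ht
    have := mem_parents.2 (hpar t ht.2)
    rw [h.parents_eq] at this
    exact (Finset.mem_insert.1 this).resolve_left ht.1

end Reverse

/-! ### Connecting equivalent HDAGs by reversals -/

theorem SameBodyAndColliders.symm {H₁ H₂ : HDAG V} (h : SameBodyAndColliders H₁ H₂) :
    SameBodyAndColliders H₂ H₁ :=
  ⟨h.1.symm, fun S j => (h.2 S j).symm⟩

theorem SameBodyAndColliders.trans {H₁ H₂ H₃ : HDAG V} (h : SameBodyAndColliders H₁ H₂)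
    (h' : SameBodyAndColliders H₂ H₃) : SameBodyAndColliders H₁ H₃ :=
  ⟨h.1.trans h'.1, fun S j => (h.2 S j).trans (h'.2 S j)⟩

/-- An edge of `H₁` is an edge of `H₂` in one of the directions. -/
theorem IsParent.or_of_body_eq {H₁ H₂ : HDAG V} (h : H₁.body = H₂.body) {a b : V}
    (hab : H₁.IsParent a b) : H₂.IsParent a b ∨ H₂.IsParent b a := by
  rw [← pair_mem_body_iff hab.ne, ← h, pair_mem_body_iff hab.ne]
  exact Or.inl hab

section Connect

variable [Fintype V] {H₁ H₂ : HDAG V}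

/-- The edges of `H₁` that have the opposite direction in `H₂`. -/
def reversedEdges (H₁ H₂ : HDAG V) : Finset (V × V) :=
  Finset.univ.filter fun e =>
    {e.1} ∈ H₁.hyperparents e.2 ∧ {e.2} ∈ H₂.hyperparents e.1

theorem mem_reversedEdges {a b : V} :
    (a, b) ∈ reversedEdges H₁ H₂ ↔ H₁.IsParent a b ∧ H₂.IsParent b a := by
  simp [reversedEdges, IsParent]

theorem hyperparents_subset_of_reversedEdges_eq_empty (h : H₁.body = H₂.body)
    (he : reversedEdges H₁ H₂ = ∅) (j : V) : H₁.hyperparents j ⊆ H₂.hyperparents j := by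
  intro S hS
  refine mem_hyperparents_of_insert_mem_body (H₁.notMem_of_mem j S hS) (fun s hs => ?_)
    (h ▸ insert_mem_body hS)
  have hp := isParent_of_mem hS hs
  refine (hp.or_of_body_eq h).resolve_right fun h' => ?_
  have : (s, j) ∈ reversedEdges H₁ H₂ := mem_reversedEdges.2 ⟨hp, h'⟩
  simp [he] at this

/-- Chickering's lemma for HDAGs: of two HDAGs with the same body and the same unshielded
multi-colliders that are oriented differently, the first has a covered edge that points the other
way in the second. Take for `y` a first vertex with an incoming edge of this kind, and for `x` the
last possible tail of such an edge; all edges into `x` then agree in the two HDAGs. -/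
theorem exists_isCovered_of_reversedEdges_nonempty (h : SameBodyAndColliders H₁ H₂)
    (he : (reversedEdges H₁ H₂).Nonempty) :
    ∃ x y, H₁.IsCovered x y ∧ H₂.IsParent y x := by
  obtain ⟨r, hr⟩ := H₁.exists_rank
  obtain ⟨r₂, hr₂⟩ := H₂.exists_rank
  obtain ⟨⟨x₀, y₀⟩, hy, hymin⟩ := (reversedEdges H₁ H₂).exists_min_image (fun e => r e.2) he
  obtain ⟨⟨x, y⟩, hx, hxmax⟩ := ((reversedEdges H₁ H₂).filter fun e => e.2 = y₀).exists_max_image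
    (fun e => r e.1) ⟨(x₀, y₀), by simp [hy]⟩
  obtain ⟨hxe, rfl : y = y₀⟩ := Finset.mem_filter.1 hx
  obtain ⟨hxy, hyx⟩ := mem_reversedEdges.1 hxe
  have hxymin : ∀ a b, r b < r y → H₁.IsParent a b → H₂.IsParent a b := by
    intro a b hb hab
    refine (hab.or_of_body_eq h.1).resolve_right fun hba => ?_
    have := hymin (a, b) (mem_reversedEdges.2 ⟨hab, hba⟩)
    simp only at this
    omega
  -- A multi-collider of one HDAG that is not a member of the body is a multi-collider of the
  -- other; sets of one element need no exception, since they are members of the body.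
  have hcoll : ∀ {S : Finset V} {j : V}, S.Nonempty → (∀ s ∈ S, H₁.IsParent s j) →
      S ∉ H₁.body → ∀ s ∈ S, H₂.IsParent s j := by
    intro S j hne hS hb
    refine (isUnshieldedMultiCollider_iff.1 ((h.2 S j).1
      (isUnshieldedMultiCollider_iff.2 ⟨?_, hS, hb⟩))).2.1
    by_contra hc
    obtain ⟨a, rfl⟩ := Finset.card_eq_one.1 (by have := hne.card_pos; omega : S.card = 1)
    exact hb (singleton_mem_body _ a)
  have hcoll' : ∀ {S : Finset V} {j : V}, S.Nonempty → (∀ s ∈ S, H₂.IsParent s j) →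
      S ∉ H₁.body → ∀ s ∈ S, H₁.IsParent s j := by
    intro S j hne hS hb
    refine (isUnshieldedMultiCollider_iff.1 ((h.2 S j).2
      (isUnshieldedMultiCollider_iff.2 ⟨?_, hS, h.1 ▸ hb⟩))).2.1
    by_contra hc
    obtain ⟨a, rfl⟩ := Finset.card_eq_one.1 (by have := hne.card_pos; omega : S.card = 1)
    exact hb (singleton_mem_body _ a)
  have hrxy := hr _ _ hxy
  have hpx : ∀ z, H₁.IsParent z x → H₂.IsParent z x := fun z hz => hxymin z x hrxy hz
  have hsub : ∀ z, H₁.IsParent z x → H₁.IsParent z y := by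
    intro z hz
    have hrz := hr _ _ hz
    have hzy : z ≠ y := by rintro rfl; omega
    by_cases hb : {z, y} ∈ H₁.body
    · refine ((pair_mem_body_iff hzy).1 hb).resolve_right fun h' => ?_
      have := hr _ _ h'
      omega
    · have := hcoll' (S := {z, y}) (j := x) (by simp) (by simp [hpx z hz, hyx]) hb y (by simp)
      exact absurd this hxy.asymm
  have hsup : ∀ w, H₁.IsParent w y → w ≠ x → H₁.IsParent w x := by
    intro w hw hwx
    by_cases hb : {w, x} ∈ H₁.body
    · refine ((pair_mem_body_iff hwx).1 hb).resolve_right fun h' => ?_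
      have hrw := hr _ _ hw
      have hrxw := hr _ _ h'
      have hwy : H₂.IsParent w y := by
        refine (hw.or_of_body_eq h.1).resolve_right fun hba => ?_
        have := hxmax (w, y) (by simp [mem_reversedEdges, hw, hba])
        simp only at this
        omega
      have := hr₂ _ _ (hxymin x w hrw h')
      have := hr₂ _ _ hwy
      have := hr₂ _ _ hyx
      omega
    · have := hcoll (S := {w, x}) (j := y) (by simp) (by simp [hw, hxy]) hb x (by simp)
      exact absurd this hyx.asymm
  have heq : H₁.parents y = insert x (H₁.parents x) := by
    ext z
    rw [Finset.mem_insert, mem_parents, mem_parents]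
    constructor
    · intro hz
      by_cases hzx : z = x
      · exact Or.inl hzx
      · exact Or.inr (hsup z hz hzx)
    · rintro (rfl | hz)
      · exact hxy
      · exact hsub z hz
  refine ⟨x, y, ⟨hxy, heq, ?_, ?_⟩, hyx⟩
  · refine mem_hyperparents_of_insert_mem_body (H₁.notMem_parents x)
      (fun s hs => mem_parents.1 hs) ?_
    by_contra hb
    have hx' : x ∈ H₁.parents y := mem_parents.2 hxy
    exact hyx.asymm (hcoll (S := insert x (H₁.parents x)) (j := y) (by simp)
      (fun s hs => mem_parents.1 (heq ▸ hs)) hb x (by simp))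
  · refine mem_hyperparents_of_insert_mem_body (fun h' => hxy.asymm (mem_parents.1 h'))
      (fun s hs => hsub s (mem_parents.1 hs)) ?_
    by_contra hb
    refine hxy.asymm (hcoll' (S := insert y (H₁.parents x)) (j := x) (by simp)
      (fun s hs => ?_) hb y (by simp))
    rcases Finset.mem_insert.1 hs with rfl | hs
    · exact hyx
    · exact hpx s (mem_parents.1 hs)

theorem reversedEdges_reverse_ssubset {x y : V} (h : H₁.IsCovered x y) (hyx : H₂.IsParent y x) :
    reversedEdges (H₁.reverse x y h) H₂ ⊂ reversedEdges H₁ H₂ := by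
  rw [Finset.ssubset_iff_of_subset]
  · refine ⟨(x, y), mem_reversedEdges.2 ⟨h.isParent, hyx⟩, ?_⟩
    rw [mem_reversedEdges, reverse_isParent_iff]
    have := h.ne
    tauto
  · rintro ⟨a, b⟩ hab
    rw [mem_reversedEdges, reverse_isParent_iff] at hab
    rw [mem_reversedEdges]
    rcases hab with ⟨h1 | ⟨rfl, rfl⟩, h2⟩
    · exact ⟨h1.1, h2⟩
    · exact absurd h2 hyx.asymm

/-- A property of HDAGs that is preserved by the reversal of covered edges passes between any two
HDAGs with the same body and the same unshielded multi-colliders. -/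
theorem SameBodyAndColliders.induction {P : HDAG V → Prop}
    (hP : ∀ (H : HDAG V) (x y : V) (h : H.IsCovered x y), P H → P (H.reverse x y h))
    {H₁ H₂ : HDAG V} (h : SameBodyAndColliders H₁ H₂) (h₁ : P H₁) : P H₂ := by
  induction hn : (reversedEdges H₁ H₂).card using Nat.strong_induction_on generalizing H₁ with
  | _ n ih =>
    rcases (reversedEdges H₁ H₂).eq_empty_or_nonempty with he | he
    · have he' : reversedEdges H₂ H₁ = ∅ := by
        ext ⟨a, b⟩
        have : (b, a) ∉ reversedEdges H₁ H₂ := by simp [he]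
        rw [mem_reversedEdges] at this ⊢
        simp only [Finset.notMem_empty, iff_false]
        tauto
      have : H₁.hyperparents = H₂.hyperparents := funext fun j =>
        (hyperparents_subset_of_reversedEdges_eq_empty h.1 he j).antisymm
          (hyperparents_subset_of_reversedEdges_eq_empty h.1.symm he' j)
      have : H₁ = H₂ := by
        cases H₁; cases H₂; cases this; rfl
      exact this ▸ h₁
    · obtain ⟨x, y, hc, hyx⟩ := exists_isCovered_of_reversedEdges_nonempty h he
      refine ih _ ?_ ((sameBodyAndColliders_reverse hc).trans h) (hP _ x y hc h₁) rfl
      rw [← hn]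
      exact Finset.card_lt_card (reversedEdges_reverse_ssubset hc hyx)

end Connect

end HDAG

/-! ### Energies and Gibbs kernels -/

section Energy

variable {V : Type*} {Ω : V → Type*}

/-- The space of real functions of the configuration that depend on the coordinates in `U` only. -/
def functionsOn (Ω : V → Type*) (U : Finset V) : Submodule ℝ ((∀ i, Ω i) → ℝ) where
  carrier := {g | DependsOn g (↑U : Set V)}
  add_mem' ha hb x y h := by simp [ha h, hb h]
  zero_mem' _ _ _ := rfl
  smul_mem' c g hg x y h := by simp [hg h]

theorem functionsOn_mono {U W : Finset V} (h : U ⊆ W) : functionsOn Ω U ≤ functionsOn Ω W :=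
  fun _ hg _ _ hxy => hg fun i hi => hxy i (h hi)

theorem comp_mem_functionsOn {U : Finset V} {g : (∀ i, Ω i) → ℝ} (hg : g ∈ functionsOn Ω U)
    (φ : ℝ → ℝ) : (fun x => φ (g x)) ∈ functionsOn Ω U :=
  fun _ _ h => congrArg φ (hg h)

variable [DecidableEq V]

theorem apply_update_of_mem_functionsOn {U : Finset V} {g : (∀ i, Ω i) → ℝ}
    (hg : g ∈ functionsOn Ω U) {i : V} (hi : i ∉ U) (x : ∀ i, Ω i) (a : Ω i) :
    g (Function.update x i a) = g x :=
  hg fun _ hj => Function.update_of_ne (ne_of_mem_of_not_mem hj hi) _ _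

theorem sum_update_mem_functionsOn [∀ i, Fintype (Ω i)] {U : Finset V} {i : V}
    {g : (∀ i, Ω i) → ℝ} (hg : g ∈ functionsOn Ω (insert i U)) :
    (fun x => ∑ a, g (Function.update x i a)) ∈ functionsOn Ω U := by
  intro x y h
  refine Finset.sum_congr rfl fun a _ => hg fun j hj => ?_
  by_cases hji : j = i
  · subst hji; simp
  · rw [Function.update_of_ne hji, Function.update_of_ne hji]
    exact h j ((Finset.mem_insert.1 hj).resolve_left hji)

/-- The energies of the vertex `i` that `H` allows: sums of functions of `x_i` and `x_S`, where
`S` runs through the hyperparents of `i`. -/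
def HDAG.energySpace (H : HDAG V) (Ω : V → Type*) (i : V) : Submodule ℝ ((∀ i, Ω i) → ℝ) :=
  ⨆ S ∈ H.hyperparents i, functionsOn Ω (insert i S)

theorem HDAG.mem_energySpace_iff {H : HDAG V} {i : V} {e : (∀ i, Ω i) → ℝ} :
    e ∈ H.energySpace Ω i ↔ ∃ θ : Finset V → (∀ i, Ω i) → ℝ,
      (∀ S ∈ H.hyperparents i, DependsOn (θ S) (↑(insert i S) : Set V)) ∧
      ∀ x, e x = ∑ S ∈ H.hyperparents i, θ S x := by
  constructor
  · intro h
    obtain ⟨μ, rfl⟩ := (Submodule.mem_iSup_finset_iff_exists_sum _ _).1 h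
    refine ⟨fun S => μ S, fun S _ => ?_, fun x => by simp⟩
    exact (μ S).2
  · rintro ⟨θ, hθ, h⟩
    have : e = ∑ S ∈ H.hyperparents i, θ S := by ext x; simp [h]
    rw [this]
    exact Submodule.sum_mem _ fun S hS =>
      Submodule.mem_iSup_of_mem S (Submodule.mem_iSup_of_mem hS (hθ S hS))

theorem HDAG.functionsOn_le_energySpace {H : HDAG V} {i : V} {S : Finset V}
    (hS : S ∈ H.hyperparents i) : functionsOn Ω (insert i S) ≤ H.energySpace Ω i :=
  fun _ h => Submodule.mem_iSup_of_mem S (Submodule.mem_iSup_of_mem hS h)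

theorem HDAG.energySpace_le [Fintype V] (H : HDAG V) (i : V) :
    H.energySpace Ω i ≤ functionsOn Ω (insert i (H.parents i)) :=
  iSup₂_le fun _ hS => functionsOn_mono (Finset.insert_subset_insert _ (HDAG.subset_parents hS))

theorem HDAG.le_energySpace_reverse [Fintype V] {H : HDAG V} {x y : V} (h : H.IsCovered x y) :
    H.energySpace Ω x ⊔ functionsOn Ω (H.parents x) ⊔
      (H.energySpace Ω y ⊔ functionsOn Ω (H.parents y)) ⊔ functionsOn Ω (insert y (H.parents x)) ≤
    (H.reverse x y h).energySpace Ω x ⊔ functionsOn Ω ((H.reverse x y h).parents x) := by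
  have hl : functionsOn Ω (insert x (H.parents x)) ≤
      (H.reverse x y h).energySpace Ω x ⊔ functionsOn Ω ((H.reverse x y h).parents x) := by
    refine le_trans (functionsOn_le_energySpace ?_) le_sup_left
    exact (mem_reverse_left h.ne).2 ⟨H.notMem_parents x, Or.inl subset_rfl⟩
  have hr : functionsOn Ω (insert y (H.parents x)) ≤
      (H.reverse x y h).energySpace Ω x ⊔ functionsOn Ω ((H.reverse x y h).parents x) := by
    rw [reverse_parents_left]
    exact le_sup_right
  refine sup_le (sup_le (sup_le ?_ ?_) (sup_le ?_ ?_)) hr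
  · exact (H.energySpace_le x).trans hl
  · exact (functionsOn_mono (Finset.subset_insert _ _)).trans hl
  · refine iSup₂_le fun S hS => ?_
    by_cases hx : x ∈ S
    · have hyS := H.notMem_of_mem y S hS
      have : insert y S = insert x (insert y (S.erase x)) := by
        rw [Finset.insert_comm, Finset.insert_erase hx]
      rw [this]
      refine le_trans (functionsOn_le_energySpace ?_) le_sup_left
      refine (mem_reverse_left h.ne).2 ⟨by simp [h.ne], Or.inr ⟨by simp, ?_⟩⟩
      rwa [Finset.erase_insert (by simp [hyS]), Finset.insert_erase hx]
    · have hsub := subset_parents hS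
      rw [h.parents_eq] at hsub
      exact (functionsOn_mono (Finset.insert_subset_insert _
        ((Finset.subset_insert_iff_of_notMem hx).1 hsub))).trans hr
  · rw [h.parents_eq]
    exact hl

variable [∀ i, Fintype (Ω i)]

/-- The conditional probability of `x_i` with energy `e`, that is, `exp (e x)` normalized over
the values of the coordinate `i`. -/
noncomputable def gibbsKernel (e : (∀ i, Ω i) → ℝ) (i : V) (x : ∀ i, Ω i) : ℝ :=
  Real.exp (e x) / ∑ a, Real.exp (e (Function.update x i a))

theorem sum_exp_update_pos (e : (∀ i, Ω i) → ℝ) (i : V) (x : ∀ i, Ω i) :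
    0 < ∑ a, Real.exp (e (Function.update x i a)) :=
  Finset.sum_pos (fun _ _ => Real.exp_pos _) ⟨x i, Finset.mem_univ _⟩

theorem gibbsKernel_pos (e : (∀ i, Ω i) → ℝ) (i : V) (x : ∀ i, Ω i) : 0 < gibbsKernel e i x :=
  div_pos (Real.exp_pos _) (sum_exp_update_pos e i x)

theorem sum_gibbsKernel_update (e : (∀ i, Ω i) → ℝ) (i : V) (x : ∀ i, Ω i) :
    ∑ a, gibbsKernel e i (Function.update x i a) = 1 := by
  simp only [gibbsKernel, Function.update_idem]
  rw [← Finset.sum_div, div_self (sum_exp_update_pos e i x).ne']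

theorem log_gibbsKernel (e : (∀ i, Ω i) → ℝ) (i : V) (x : ∀ i, Ω i) :
    Real.log (gibbsKernel e i x) =
      e x - Real.log (∑ a, Real.exp (e (Function.update x i a))) := by
  rw [gibbsKernel, Real.log_div (Real.exp_pos _).ne' (sum_exp_update_pos e i x).ne', Real.log_exp]

/-- The log-normalizer of the vertex `i` depends on the other coordinates only. -/
theorem log_sum_exp_update_mem {e : (∀ i, Ω i) → ℝ} {i : V} {U : Finset V}
    (he : e ∈ functionsOn Ω (insert i U)) :
    (fun x => Real.log (∑ a, Real.exp (e (Function.update x i a)))) ∈ functionsOn Ω U :=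
  comp_mem_functionsOn (sum_update_mem_functionsOn (comp_mem_functionsOn he Real.exp)) Real.log

theorem gibbsKernel_mem_functionsOn {e : (∀ i, Ω i) → ℝ} {i : V} {U : Finset V}
    (he : e ∈ functionsOn Ω (insert i U)) :
    gibbsKernel e i ∈ functionsOn Ω (insert i U) := by
  intro x y h
  have h1 := log_sum_exp_update_mem he (x := x) (y := y) fun j hj => h j (by simp at hj; simp [hj])
  rw [← Real.exp_log (gibbsKernel_pos e i x), ← Real.exp_log (gibbsKernel_pos e i y),
    log_gibbsKernel, log_gibbsKernel, he h]
  simp only at h1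
  rw [h1]

/-- An energy that is already normalized up to a function of the other coordinates. -/
theorem gibbsKernel_eq_exp {e c : (∀ i, Ω i) → ℝ} {i : V} {U : Finset V} (hi : i ∉ U)
    (hc : c ∈ functionsOn Ω U) (x : ∀ i, Ω i)
    (h : ∑ a, Real.exp ((e + c) (Function.update x i a)) = 1) :
    gibbsKernel e i x = Real.exp ((e + c) x) := by
  simp only [Pi.add_apply, Real.exp_add, apply_update_of_mem_functionsOn hc hi,
    ← Finset.sum_mul] at h ⊢
  rw [gibbsKernel, div_eq_iff (sum_exp_update_pos e i x).ne', mul_assoc, mul_comm (Real.exp (c x)),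
    h, mul_one]

end Energy

/-! ### Markov distributions and reversals -/

section Markov

variable {V : Type*} [Fintype V] [DecidableEq V] {Ω : V → Type*} [∀ i, Fintype (Ω i)]

theorem PosDist.isMarkov_iff {p : PosDist Ω} {H : HDAG V} :
    p.IsMarkov H ↔ ∃ e : V → (∀ i, Ω i) → ℝ, (∀ i, e i ∈ H.energySpace Ω i) ∧
      ∀ x, p.mass x = ∏ i, gibbsKernel (e i) i x := by
  have key : ∀ (e : V → (∀ i, Ω i) → ℝ) x, p.mass x = ∏ i, gibbsKernel (e i) i x ↔
      Real.log (p.mass x) =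
        ∑ i, (e i x - Real.log (∑ a, Real.exp (e i (Function.update x i a)))) := by
    intro e x
    simp only [← log_gibbsKernel]
    rw [← Real.log_prod fun i _ => (gibbsKernel_pos (e i) i x).ne']
    exact ⟨fun h => by rw [h], fun h => Real.log_injOn_pos (p.pos x)
      (Finset.prod_pos fun i _ => gibbsKernel_pos (e i) i x) h⟩
  constructor
  · rintro ⟨θ, hθ, h⟩
    refine ⟨fun i x => ∑ S ∈ H.hyperparents i, θ i S x,
      fun i => HDAG.mem_energySpace_iff.2 ⟨θ i, hθ i, fun x => rfl⟩, fun x => (key _ x).2 (h x)⟩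
  · rintro ⟨e, he, h⟩
    choose θ hθ heθ using fun i => HDAG.mem_energySpace_iff.1 (he i)
    refine ⟨θ, hθ, fun x => ?_⟩
    simp only [← heθ]
    exact (key e x).1 (h x)

/-- A Markov distribution is a product of conditional distributions whose logarithms are allowed
energies up to functions of the parents. -/
theorem PosDist.isMarkov_iff_exists_log_kernel {p : PosDist Ω} {H : HDAG V} :
    p.IsMarkov H ↔ ∃ f : V → (∀ i, Ω i) → ℝ,
      (∀ i, f i ∈ H.energySpace Ω i ⊔ functionsOn Ω (H.parents i)) ∧
      (∀ i x, ∑ a, Real.exp (f i (Function.update x i a)) = 1) ∧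
      ∀ x, p.mass x = ∏ i, Real.exp (f i x) := by
  rw [isMarkov_iff]
  constructor
  · rintro ⟨e, he, h⟩
    refine ⟨fun i x => Real.log (gibbsKernel (e i) i x), fun i => ?_, fun i x => ?_, fun x => ?_⟩
    · have : (fun x => Real.log (gibbsKernel (e i) i x)) =
          e i - fun x => Real.log (∑ a, Real.exp (e i (Function.update x i a))) := by
        ext x
        simp [log_gibbsKernel]
      simp only [this]
      exact sub_mem (Submodule.mem_sup_left (he i)) (Submodule.mem_sup_right
        (log_sum_exp_update_mem (H.energySpace_le i (he i))))
    · simp only [Real.exp_log (gibbsKernel_pos _ _ _)]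
      exact sum_gibbsKernel_update (e i) i x
    · simp only [Real.exp_log (gibbsKernel_pos _ _ _)]
      exact h x
  · rintro ⟨f, hf, hn, h⟩
    choose e he c hc hec using fun i => Submodule.mem_sup.1 (hf i)
    refine ⟨e, he, fun x => (h x).trans (Finset.prod_congr rfl fun i _ => ?_)⟩
    rw [gibbsKernel_eq_exp (H.notMem_parents i) (hc i), hec]
    rw [hec]
    exact hn i x

/-- Reversal of a covered edge `x → y` keeps a distribution Markov: the product of the conditional
distributions of `x` and `y` is split anew, by Bayes' rule, into the one of `y` given the parents of
`x` and the one of `x` given `y` and these parents. -/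
theorem PosDist.IsMarkov.reverse {p : PosDist Ω} {H : HDAG V} {x y : V} (h : H.IsCovered x y)
    (hp : p.IsMarkov H) : p.IsMarkov (H.reverse x y h) := by
  obtain ⟨f, hf, hn, hm⟩ := PosDist.isMarkov_iff_exists_log_kernel.1 hp
  rw [PosDist.isMarkov_iff_exists_log_kernel]
  have hxy := h.ne
  have hU : ∀ i, f i ∈ functionsOn Ω (insert i (H.parents i)) := fun i =>
    sup_le (H.energySpace_le i) (functionsOn_mono (Finset.subset_insert _ _)) (hf i)
  have hfx : f x ∈ functionsOn Ω (insert x (insert y (H.parents x))) :=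
    functionsOn_mono (Finset.insert_subset_insert _ (Finset.subset_insert _ _)) (hU x)
  have hfy : f y ∈ functionsOn Ω (insert x (insert y (H.parents x))) := by
    have := hU y
    rwa [h.parents_eq, Finset.insert_comm] at this
  have hfxy : ∀ z a, f x (Function.update z y a) = f x z := fun z a =>
    apply_update_of_mem_functionsOn (hU x) (by simp [hxy.symm, h.notMem]) z a
  set g : (∀ i, Ω i) → ℝ :=
    fun z => Real.log (∑ a, Real.exp ((f x + f y) (Function.update z x a))) with hg
  have hgU : g ∈ functionsOn Ω (insert y (H.parents x)) :=
    log_sum_exp_update_mem (add_mem hfx hfy)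
  have hgexp : ∀ z, Real.exp (g z) = ∑ a, Real.exp ((f x + f y) (Function.update z x a)) :=
    fun z => Real.exp_log (sum_exp_update_pos _ _ _)
  have hgx : ∀ z a, g (Function.update z x a) = g z := fun z a =>
    apply_update_of_mem_functionsOn hgU (by simp [hxy, H.notMem_parents]) z a
  refine ⟨fun i => if i = y then g else if i = x then f x + f y - g else f i, ?_, ?_, ?_⟩
  · intro i
    by_cases hiy : i = y
    · subst hiy
      simp only [if_true]
      refine Submodule.mem_sup_left (HDAG.functionsOn_le_energySpace ?_ hgU)
      exact HDAG.mem_reverse_right.2 subset_rfl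
    by_cases hix : i = x
    · subst hix
      simp only [if_neg hiy, if_true]
      refine HDAG.le_energySpace_reverse h ?_
      exact sub_mem (Submodule.mem_sup_left (add_mem (Submodule.mem_sup_left (hf i))
        (Submodule.mem_sup_right (hf y)))) (Submodule.mem_sup_right hgU)
    · simp only [if_neg hiy, if_neg hix]
      have h1 : (H.reverse x y h).energySpace Ω i = H.energySpace Ω i := by
        unfold HDAG.energySpace
        rw [show (H.reverse x y h).hyperparents i = H.hyperparents i from
          HDAG.mem_reverse_of_ne hix hiy]
      have h2 : (H.reverse x y h).parents i = H.parents i := by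
        unfold HDAG.parents
        rw [show (H.reverse x y h).hyperparents i = H.hyperparents i from
          HDAG.mem_reverse_of_ne hix hiy]
      rw [h1, h2]
      exact hf i
  · intro i z
    by_cases hiy : i = y
    · subst hiy
      simp only [if_true, hgexp]
      rw [Finset.sum_comm, ← hn x z]
      refine Finset.sum_congr rfl fun a _ => ?_
      simp only [Function.update_comm hxy.symm, Pi.add_apply, Real.exp_add, hfxy,
        ← Finset.mul_sum, hn, mul_one]
    by_cases hix : i = x
    · subst hix
      simp only [if_neg hiy, if_true, Pi.sub_apply, Real.exp_sub, hgx, ← Finset.sum_div, ← hgexp]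
      exact div_self (Real.exp_pos _).ne'
    · simp only [if_neg hiy, if_neg hix]
      exact hn i z
  · intro z
    rw [hm z, ← Finset.mul_prod_erase _ _ (Finset.mem_univ x),
      ← Finset.mul_prod_erase _ _ (Finset.mem_erase.2 ⟨hxy.symm, Finset.mem_univ y⟩),
      ← Finset.mul_prod_erase Finset.univ _ (Finset.mem_univ x),
      ← Finset.mul_prod_erase (Finset.univ.erase x) _
        (Finset.mem_erase.2 ⟨hxy.symm, Finset.mem_univ y⟩), ← mul_assoc, ← mul_assoc]
    congr 1
    · simp only [if_neg hxy, if_true, ← Real.exp_add]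
      simp
    · refine Finset.prod_congr rfl fun i hi => ?_
      simp only [Finset.mem_erase, Finset.mem_univ, and_true] at hi
      simp only [if_neg hi.1, if_neg hi.2]

theorem HDAG.SameBodyAndColliders.isMarkov {H₁ H₂ : HDAG V}
    (h : HDAG.SameBodyAndColliders H₁ H₂) {p : PosDist Ω} (hp : p.IsMarkov H₁) : p.IsMarkov H₂ :=
  h.induction (P := fun H => p.IsMarkov H) (fun _ _ _ hc hp => hp.reverse hc) hp

theorem HDAG.SameBodyAndColliders.induces_iff {H₁ H₂ : HDAG V}
    (h : HDAG.SameBodyAndColliders H₁ H₂) (T Z : Finset V) :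
    H₁.Induces Ω T Z ↔ H₂.Induces Ω T Z :=
  ⟨fun h' p hp => h' p (h.symm.isMarkov hp), fun h' p hp => h' p (h.isMarkov hp)⟩

end Markov

/-! ### Marginals on ancestral sets -/

section Marginal

variable {V : Type*} [Fintype V] [DecidableEq V] {Ω : V → Type*} [∀ i, Fintype (Ω i)]

open Classical in
/-- The sum of `m` over all coordinates outside `A`. -/
noncomputable def marginalSum (m : (∀ i, Ω i) → ℝ) (A : Finset V) (x : ∀ i, Ω i) : ℝ :=
  ∑ y with (∀ i ∈ A, y i = x i), m y

theorem PosDist.marginal_eq (p : PosDist Ω) (A : Finset V) :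
    p.marginal A = marginalSum p.mass A := rfl

theorem marginalSum_univ (m : (∀ i, Ω i) → ℝ) (x : ∀ i, Ω i) :
    marginalSum m Finset.univ x = m x := by
  classical
  have : (Finset.univ.filter fun y : ∀ i, Ω i => ∀ i ∈ Finset.univ, y i = x i) = {x} := by
    ext y
    simp [funext_iff]
  unfold marginalSum
  convert Finset.sum_singleton m x

theorem marginalSum_empty (m : (∀ i, Ω i) → ℝ) (x : ∀ i, Ω i) :
    marginalSum m ∅ x = ∑ y, m y := by
  simp [marginalSum]

theorem marginalSum_mem_functionsOn (m : (∀ i, Ω i) → ℝ) (A : Finset V) :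
    marginalSum m A ∈ functionsOn Ω A := by
  intro x y h
  unfold marginalSum
  congr 1
  ext z
  simp only [Finset.mem_filter, Finset.mem_univ, true_and]
  exact forall₂_congr fun i hi => by rw [h i hi]

theorem PosDist.marginal_pos (p : PosDist Ω) (A : Finset V) (x : ∀ i, Ω i) :
    0 < p.marginal A x :=
  Finset.sum_pos (fun y _ => p.pos y) ⟨x, by simp⟩

theorem marginalSum_eq_sum_update (m : (∀ i, Ω i) → ℝ) {A : Finset V} {s : V} (hs : s ∉ A)
    (x : ∀ i, Ω i) :
    marginalSum m A x = ∑ a, marginalSum m (insert s A) (Function.update x s a) := by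
  classical
  unfold marginalSum
  rw [← Finset.sum_fiberwise (s := Finset.univ.filter _) (g := fun y : ∀ i, Ω i => y s)]
  refine Finset.sum_congr rfl fun a _ => ?_
  rw [Finset.filter_filter]
  refine Finset.sum_congr ?_ fun _ _ => rfl
  ext y
  simp only [Finset.mem_filter, Finset.mem_univ, true_and, Finset.mem_insert, forall_eq_or_imp,
    Function.update_self]
  rw [and_comm]
  refine and_congr_right fun _ => forall₂_congr fun i hi => ?_
  rw [Function.update_of_ne (ne_of_mem_of_not_mem hi hs)]

/-- The marginal of a product of conditional distributions on an ancestral set `A` is the product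
of those of the vertices in `A`. The acyclic structure is given by a rank function `r`. -/
theorem marginalSum_prod_eq {k : V → (∀ i, Ω i) → ℝ} {P : V → Finset V} {r : V → ℕ}
    (hr : ∀ i, ∀ j ∈ P i, r j < r i) (hk : ∀ i, k i ∈ functionsOn Ω (insert i (P i)))
    (hsum : ∀ i x, ∑ a, k i (Function.update x i a) = 1) {A : Finset V}
    (hA : ∀ i ∈ A, P i ⊆ A) (x : ∀ i, Ω i) :
    marginalSum (fun y => ∏ i, k i y) A x = ∏ i ∈ A, k i x := by
  induction hn : Aᶜ.card generalizing A x with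
  | zero =>
    have : A = Finset.univ := by
      rwa [Finset.card_eq_zero, Finset.compl_eq_empty_iff] at hn
    subst this
    exact marginalSum_univ _ x
  | succ n ih =>
    obtain ⟨s, hs, hmin⟩ := Aᶜ.exists_min_image r (Finset.card_pos.1 (by omega))
    rw [Finset.mem_compl] at hs
    have hPs : P s ⊆ A := fun j hj => by
      by_contra hjA
      have := hmin j (Finset.mem_compl.2 hjA)
      have := hr s j hj
      omega
    have hA' : ∀ i ∈ insert s A, P i ⊆ insert s A := by
      intro i hi
      rcases Finset.mem_insert.1 hi with rfl | hi
      · exact hPs.trans (Finset.subset_insert _ _)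
      · exact (hA i hi).trans (Finset.subset_insert _ _)
    have hcard : (insert s A)ᶜ.card = n := by
      rw [Finset.compl_insert, Finset.card_erase_of_mem (Finset.mem_compl.2 hs)]
      omega
    rw [marginalSum_eq_sum_update _ hs]
    simp only [ih hA' _ hcard, Finset.prod_insert hs]
    have hrest : ∀ a, ∏ i ∈ A, k i (Function.update x s a) = ∏ i ∈ A, k i x := fun a =>
      Finset.prod_congr rfl fun i hi =>
        apply_update_of_mem_functionsOn (functionsOn_mono (Finset.insert_subset hi (hA i hi)) (hk i))
          hs x a
    simp only [hrest, ← Finset.sum_mul, hsum, one_mul]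

end Marginal

/-! ### Energies of full order -/

section FullOrder

variable {V : Type*} {Ω : V → Type*}

/-- The alternating sum over the subsets of `T`, which extracts the energy of full order. -/
def altSum (T : Finset V) (φ : Finset V → ℝ) : ℝ :=
  ∑ A ∈ T.powerset, (-1) ^ A.card * φ A

theorem altSum_sub (T : Finset V) (φ ψ : Finset V → ℝ) :
    altSum T (fun A => φ A - ψ A) = altSum T φ - altSum T ψ := by
  simp [altSum, mul_sub]

/-- If `φ` differs at the empty set from a function with vanishing alternating sum only, then its
alternating sum is the difference. -/
theorem altSum_eq_sub {T : Finset V} {φ ψ : Finset V → ℝ}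
    (h : ∀ A ⊆ T, A.Nonempty → φ A = ψ A) (hψ : altSum T ψ = 0) : altSum T φ = φ ∅ - ψ ∅ := by
  rw [← sub_zero (altSum T φ), ← hψ, ← altSum_sub, altSum,
    Finset.sum_eq_single_of_mem ∅ (Finset.empty_mem_powerset T)]
  · simp
  · intro A hA hne
    rw [h A (Finset.mem_powerset.1 hA) (Finset.nonempty_iff_ne_empty.2 hne)]
    simp

variable [DecidableEq V]

theorem altSum_eq_zero {T : Finset V} {φ : Finset V → ℝ} {t : V} (ht : t ∈ T)
    (h : ∀ A ⊆ T.erase t, φ (insert t A) = φ A) : altSum T φ = 0 := by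
  unfold altSum
  rw [← Finset.insert_erase ht, Finset.sum_powerset_insert (Finset.notMem_erase t T),
    ← Finset.sum_add_distrib]
  refine Finset.sum_eq_zero fun A hA => ?_
  have hA := Finset.mem_powerset.1 hA
  rw [h A hA, Finset.card_insert_of_notMem fun hm => by simpa using hA hm]
  ring

/-- The functions of `x_{T ∪ Z}` without an energy term of full order in `T`: sums of functions
each of which omits the coordinate of some `t ∈ T`. -/
def lowOrder (Ω : V → Type*) (T Z : Finset V) : Submodule ℝ ((∀ i, Ω i) → ℝ) :=
  ⨆ t ∈ T, functionsOn Ω (T.erase t ∪ Z)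

theorem functionsOn_le_lowOrder {T Z U : Finset V} (hU : U ⊆ T ∪ Z) (hT : ¬ T ⊆ U) :
    functionsOn Ω U ≤ lowOrder Ω T Z := by
  obtain ⟨t, ht, htU⟩ := Finset.not_subset.1 hT
  refine le_trans (functionsOn_mono fun i hi => ?_)
    (le_iSup₂_of_le (f := fun t _ => functionsOn Ω (T.erase t ∪ Z)) t ht le_rfl)
  have := hU hi
  have hit : i ≠ t := ne_of_mem_of_not_mem hi htU
  simp only [Finset.mem_union, Finset.mem_erase] at this ⊢
  tauto

theorem altSum_eq_zero_of_mem_lowOrder {T Z : Finset V} (hTZ : Disjoint T Z)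
    {g : (∀ i, Ω i) → ℝ} (hg : g ∈ lowOrder Ω T Z) (b b' : ∀ i, Ω i) :
    altSum T (fun A => g (A.piecewise b b')) = 0 := by
  obtain ⟨μ, rfl⟩ := (Submodule.mem_iSup_finset_iff_exists_sum _ _).1 hg
  have : altSum T (fun A => (∑ t ∈ T, (μ t : (∀ i, Ω i) → ℝ)) (A.piecewise b b')) =
      ∑ t ∈ T, altSum T (fun A => (μ t : (∀ i, Ω i) → ℝ) (A.piecewise b b')) := by
    simp only [altSum, Finset.sum_apply, Finset.mul_sum]
    exact Finset.sum_comm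
  rw [this]
  refine Finset.sum_eq_zero fun t ht => altSum_eq_zero ht fun A _ => ?_
  have htU : t ∉ T.erase t ∪ Z := by simp [Finset.disjoint_left.1 hTZ ht]
  rw [Finset.piecewise_insert]
  exact apply_update_of_mem_functionsOn (μ t).2 htU _ _

end FullOrder

/-! ### Induced multi-independences -/

section Separation

variable {V : Type*} [DecidableEq V] {Ω : V → Type*}

theorem PosDist.multiIndep_iff [Fintype V] [∀ i, Fintype (Ω i)] {p : PosDist Ω} {T Z : Finset V}
    (hT : T.Nonempty) (hTZ : Disjoint T Z) :
    p.MultiIndep T Z ↔ (fun x => Real.log (p.marginal (T ∪ Z) x)) ∈ lowOrder Ω T Z := by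
  have hlog : ∀ x, Real.log (p.marginal (T ∪ Z) x / p.marginal Z x) =
      Real.log (p.marginal (T ∪ Z) x) - Real.log (p.marginal Z x) := fun x =>
    Real.log_div (p.marginal_pos _ x).ne' (p.marginal_pos _ x).ne'
  have hZ : functionsOn Ω Z ≤ lowOrder Ω T Z := by
    refine functionsOn_le_lowOrder Finset.subset_union_right fun h => ?_
    obtain ⟨t, ht⟩ := hT
    exact Finset.disjoint_left.1 hTZ ht (h ht)
  have hmZ : (fun x => Real.log (p.marginal Z x)) ∈ functionsOn Ω Z :=
    comp_mem_functionsOn (marginalSum_mem_functionsOn p.mass Z) Real.log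
  constructor
  · rintro ⟨θ, c, hθ, hc, h⟩
    have : (fun x => Real.log (p.marginal (T ∪ Z) x)) =
        ∑ t ∈ T, θ t + c + fun x => Real.log (p.marginal Z x) := by
      ext x
      have := h x
      rw [hlog] at this
      simp only [Pi.add_apply, Finset.sum_apply]
      linarith
    rw [this]
    refine add_mem (add_mem (Submodule.sum_mem _ fun t ht => ?_) (hZ hc)) (hZ hmZ)
    exact Submodule.mem_iSup_of_mem t (Submodule.mem_iSup_of_mem ht (hθ t ht))
  · intro h
    obtain ⟨μ, hμ⟩ := (Submodule.mem_iSup_finset_iff_exists_sum _ _).1 h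
    refine ⟨fun t => μ t, -fun x => Real.log (p.marginal Z x), fun t _ => (μ t).2,
      neg_mem hmZ, fun x => ?_⟩
    rw [hlog, ← congrFun hμ x]
    simp [sub_eq_add_neg]

/-- Non-members of the body can be separated: condition on all other vertices whose rank is below
the largest rank in `T`. This set contains no common child of `T`. -/
theorem HDAG.exists_induces_of_notMem_body [Fintype V] [∀ i, Fintype (Ω i)] {H : HDAG V}
    {T : Finset V} (hT : T.Nonempty) (hTH : T ∉ H.body) :
    ∃ Z, Disjoint T Z ∧ H.Induces Ω T Z ∧ ∀ j, (∀ t ∈ T, H.IsParent t j) → j ∉ Z := by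
  obtain ⟨r, hr⟩ := H.exists_rank
  obtain ⟨m, hm, hmax⟩ := T.exists_max_image r hT
  set Z := (Finset.univ.filter fun v => r v < r m) \ T with hZ
  have hTZ : Disjoint T Z := Finset.disjoint_sdiff
  have hle : ∀ i ∈ T ∪ Z, r i ≤ r m := by
    intro i hi
    rcases Finset.mem_union.1 hi with hi | hi
    · exact hmax i hi
    · simp [hZ] at hi
      omega
  have hanc : ∀ i ∈ T ∪ Z, H.parents i ⊆ T ∪ Z := by
    intro i hi j hj
    have h1 := hr _ _ (mem_parents.1 hj)
    have h2 := hle i hi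
    by_cases hjT : j ∈ T
    · exact Finset.mem_union_left _ hjT
    · refine Finset.mem_union_right _ ?_
      simp [hZ, hjT]
      omega
  refine ⟨Z, hTZ, fun p hp => ?_, fun j hj hjZ => ?_⟩
  · obtain ⟨f, hf, hn, hmass⟩ := PosDist.isMarkov_iff_exists_log_kernel.1 hp
    rw [PosDist.multiIndep_iff hT hTZ]
    have hmarg : ∀ x, p.marginal (T ∪ Z) x = ∏ i ∈ T ∪ Z, Real.exp (f i x) := by
      intro x
      rw [PosDist.marginal_eq, funext hmass]
      refine marginalSum_prod_eq (k := fun i x => Real.exp (f i x)) (P := H.parents) (r := r)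
        (fun i j hj => hr _ _ (mem_parents.1 hj)) (fun i => comp_mem_functionsOn ?_ Real.exp)
        hn hanc x
      exact sup_le (H.energySpace_le i) (functionsOn_mono (Finset.subset_insert _ _)) (hf i)
    have : (fun x => Real.log (p.marginal (T ∪ Z) x)) = ∑ i ∈ T ∪ Z, f i := by
      ext x
      rw [hmarg, ← Real.exp_sum, Real.log_exp, Finset.sum_apply]
    rw [this]
    refine Submodule.sum_mem _ fun i hi => ?_
    -- No vertex of `T ∪ Z` lies above all of `T`.
    have hno : ¬ T ⊆ H.parents i := fun h => by
      have h1 := hr _ _ (mem_parents.1 (h hm))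
      have h2 := hle i hi
      omega
    refine sup_le (iSup₂_le fun S hS => ?_)
      (functionsOn_le_lowOrder (hanc i hi) hno) (hf i)
    refine functionsOn_le_lowOrder
      (Finset.insert_subset hi ((subset_parents hS).trans (hanc i hi))) fun h => ?_
    by_cases hiT : i ∈ T
    · refine hTH (mem_body_iff.2 ⟨i, hiT, H.mem_of_subset _ _ hS _ ?_⟩)
      exact Finset.subset_insert_iff.1 h
    · exact hno (((Finset.subset_insert_iff_of_notMem hiT).1 h).trans (subset_parents hS))
  · have h1 := hr _ _ (hj m hm)
    have h2 := hle j (Finset.mem_union_right _ hjZ)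
    omega

end Separation

/-! ### Inseparability of the members of the body -/

section Witness

variable {V : Type*} [DecidableEq V] {Ω : V → Type*} [∀ i, Fintype (Ω i)]

theorem gibbsKernel_zero (i : V) (x : ∀ i, Ω i) :
    gibbsKernel (0 : (∀ i, Ω i) → ℝ) i x = 1 / Fintype.card (Ω i) := by
  simp [gibbsKernel]

theorem log_gibbsKernel_zero_mem (i : V) (U : Finset V) :
    (fun x => Real.log (gibbsKernel (0 : (∀ i, Ω i) → ℝ) i x)) ∈ functionsOn Ω U := by
  simp only [gibbsKernel_zero]
  exact fun _ _ _ => rfl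

variable [Fintype V]

/-- Every choice of allowed energies gives a Markov distribution. If the energy of `i` involves only
the subset `P i` of the parents, then the marginals are products of kernels already on the sets that
are closed under `P`. -/
theorem HDAG.exists_isMarkov (H : HDAG V) [∀ i, Nonempty (Ω i)] {e : V → (∀ i, Ω i) → ℝ}
    (he : ∀ i, e i ∈ H.energySpace Ω i) {P : V → Finset V} (hP : ∀ i, P i ⊆ H.parents i)
    (heP : ∀ i, e i ∈ functionsOn Ω (insert i (P i))) :
    ∃ p : PosDist Ω, p.IsMarkov H ∧ ∀ A : Finset V, (∀ i ∈ A, P i ⊆ A) → ∀ x,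
      p.marginal A x = ∏ i ∈ A, gibbsKernel (e i) i x := by
  obtain ⟨r, hr⟩ := H.exists_rank
  have key : ∀ A : Finset V, (∀ i ∈ A, P i ⊆ A) → ∀ x,
      marginalSum (fun x => ∏ i, gibbsKernel (e i) i x) A x = ∏ i ∈ A, gibbsKernel (e i) i x :=
    fun A hA x => marginalSum_prod_eq (fun i j hj => hr _ _ (mem_parents.1 (hP i hj)))
      (fun i => gibbsKernel_mem_functionsOn (heP i)) (fun i => sum_gibbsKernel_update (e i) i) hA x
  refine ⟨⟨fun x => ∏ i, gibbsKernel (e i) i x,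
    fun x => Finset.prod_pos fun i _ => gibbsKernel_pos _ _ _, ?_⟩,
    PosDist.isMarkov_iff.2 ⟨e, he, fun _ => rfl⟩, key⟩
  have x : ∀ i, Ω i := fun i => Classical.arbitrary _
  have := key ∅ (by simp) x
  rwa [marginalSum_empty, Finset.prod_empty] at this

/-- A member of the body is inseparable: an energy that singles out one state of its variables
survives in every marginal. -/
theorem HDAG.not_induces_of_mem_body [∀ i, Nontrivial (Ω i)] {H : HDAG V} {T Z : Finset V}
    (hTH : T ∈ H.body) (hTZ : Disjoint T Z) : ¬ H.Induces Ω T Z := by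
  classical
  obtain ⟨j, hj, hS⟩ := mem_body_iff.1 hTH
  choose b b' hb using fun i => exists_pair_ne (Ω i)
  set g : (∀ i, Ω i) → ℝ := fun x => if ∀ t ∈ T, x t = b t then 1 else 0 with hg
  have hgT : g ∈ functionsOn Ω (insert j (T.erase j)) := by
    rw [Finset.insert_erase hj]
    intro x y h
    have : (∀ t ∈ T, x t = b t) ↔ ∀ t ∈ T, y t = b t :=
      forall₂_congr fun t ht => by rw [h t ht]
    simp only [hg, this]
  obtain ⟨p, hp, hmarg⟩ := H.exists_isMarkov (Ω := Ω) (e := fun i => if i = j then g else 0)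
    (P := fun i => if i = j then T.erase j else ∅)
    (fun i => by
      split_ifs with h
      · subst h; exact functionsOn_le_energySpace hS hgT
      · exact zero_mem _)
    (fun i => by
      split_ifs with h
      · subst h; exact subset_parents hS
      · simp)
    (fun i => by
      split_ifs with h
      · subst h; exact hgT
      · exact zero_mem _)
  intro hind
  have hT : T.Nonempty := ⟨j, hj⟩
  have hmi := (PosDist.multiIndep_iff hT hTZ).1 (hind p hp)
  have hlow : ∀ U : Finset V, U ⊆ T ∪ Z → ¬ T ⊆ U → functionsOn Ω U ≤ lowOrder Ω T Z :=
    fun U hU hTU => functionsOn_le_lowOrder hU hTU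
  have hjTZ : j ∈ T ∪ Z := Finset.mem_union_left _ hj
  have heq : (fun x => Real.log (p.marginal (T ∪ Z) x)) =
      g - (fun x => Real.log (∑ a, Real.exp (g (Function.update x j a)))) +
        ∑ i ∈ (T ∪ Z).erase j, fun x => Real.log (gibbsKernel (0 : (∀ i, Ω i) → ℝ) i x) := by
    ext x
    rw [hmarg, Real.log_prod fun i _ => (gibbsKernel_pos _ i x).ne',
      ← Finset.add_sum_erase _ _ hjTZ]
    · simp only [if_true, log_gibbsKernel g j x, Pi.add_apply, Pi.sub_apply, Finset.sum_apply]
      congr 1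
      refine Finset.sum_congr rfl fun i hi => ?_
      rw [if_neg (Finset.ne_of_mem_erase hi)]
    · intro i hi
      split_ifs with h
      · exact (Finset.erase_subset _ _).trans Finset.subset_union_left
      · simp
  have hgmem : g ∈ lowOrder Ω T Z := by
    have h1 : (fun x => Real.log (∑ a, Real.exp (g (Function.update x j a)))) ∈
        lowOrder Ω T Z :=
      hlow _ ((Finset.erase_subset _ _).trans Finset.subset_union_left)
        (fun h => by simpa using h hj) (log_sum_exp_update_mem hgT)
    have h2 : (∑ i ∈ (T ∪ Z).erase j,
        fun x => Real.log (gibbsKernel (0 : (∀ i, Ω i) → ℝ) i x)) ∈ lowOrder Ω T Z :=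
      Submodule.sum_mem _ fun i _ => hlow ∅ (Finset.empty_subset _)
        (fun h => hT.ne_empty (Finset.subset_empty.1 h)) (log_gibbsKernel_zero_mem i ∅)
    rw [heq] at hmi
    have := add_mem (sub_mem hmi h2) h1
    rwa [add_sub_cancel_right, sub_add_cancel] at this
  have h0 := altSum_eq_zero_of_mem_lowOrder hTZ hgmem b b'
  have h1 : altSum T (fun A => g (A.piecewise b b')) = (-1) ^ T.card := by
    rw [altSum, Finset.sum_eq_single_of_mem T (Finset.mem_powerset_self T)]
    · simp +contextual [hg, Finset.piecewise]
    · intro A hA hne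
      obtain ⟨t, ht, htA⟩ := Finset.exists_of_ssubset
        (Finset.ssubset_iff_subset_ne.2 ⟨Finset.mem_powerset.1 hA, hne⟩)
      have : ¬ ∀ t ∈ T, A.piecewise b b' t = b t := fun h => by
        have := h t ht
        rw [Finset.piecewise_eq_of_notMem _ _ _ htA] at this
        exact hb t this.symm
      simp [hg, this]
  rw [h1] at h0
  exact absurd h0 (by simp)

end Witness

/-! ### Stars -/

section Star

theorem sum_ite_eq_add_mul {α : Type*} [Fintype α] [DecidableEq α] (c : α) (u v : ℝ) :
    ∑ a, (if a = c then u else v) = u + (Fintype.card α - 1) * v := by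
  have : ∀ a, (if a = c then u else v) = v + if a = c then u - v else 0 := fun a => by
    split_ifs <;> ring
  simp only [this, Finset.sum_add_distrib, Finset.sum_ite_eq', Finset.mem_univ, if_true]
  simp
  ring

theorem eq_zero_of_continuousAt_of_pos {h : ℝ → ℝ} (hc : ContinuousAt h 0)
    (h0 : ∀ ε, 0 < ε → h ε = 0) : h 0 = 0 := by
  have h1 : Filter.Tendsto h (nhdsWithin 0 (Set.Ioi 0)) (nhds (h 0)) :=
    hc.tendsto.mono_left nhdsWithin_le_nhds
  have h2 : Filter.Tendsto h (nhdsWithin 0 (Set.Ioi 0)) (nhds 0) := by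
    refine tendsto_const_nhds.congr' ?_
    filter_upwards [self_mem_nhdsWithin] with ε hε using (h0 ε hε).symm
  exact tendsto_nhds_unique h1 h2

theorem one_le_card_sub_one (α : Type*) [Fintype α] [Nontrivial α] :
    (1 : ℝ) ≤ Fintype.card α - 1 := by
  have : (2 : ℝ) ≤ Fintype.card α := by exact_mod_cast Fintype.one_lt_card
  linarith

variable {V : Type*} {Ω : V → Type*}

theorem pair_mem_functionsOn [∀ i, DecidableEq (Ω i)] (c : ℝ) (b : ∀ i, Ω i) {s t : V}
    {U : Finset V} (hs : s ∈ U) (ht : t ∈ U) :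
    (fun x => if x s = b s ∧ x t = b t then c else 0) ∈ functionsOn Ω U := by
  intro x y h
  simp only [h s hs, h t ht]

variable [DecidableEq V]

open Classical in
/-- The energies of a star with centre `j`, whose arms point towards `j` from `T₁` and away from
`j` to `T₂`. Each arm has a pure pair interaction: the weight `ε` whenever both of its ends are
in the states given by `b`. -/
noncomputable def starEnergy (ε : ℝ) (b : ∀ i, Ω i) (j : V) (T₁ T₂ : Finset V) (i : V) :
    (∀ i, Ω i) → ℝ :=
  if i = j then ∑ t ∈ T₁, fun x => if x j = b j ∧ x t = b t then Real.log ε else 0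
  else if i ∈ T₂ then fun x => if x j = b j ∧ x i = b i then Real.log ε else 0
  else 0

variable {ε : ℝ} {b : ∀ i, Ω i} {j : V} {T₁ T₂ : Finset V}

section Values

variable {b' : ∀ i, Ω i} {A : Finset V}

open Classical in
theorem exp_starEnergy_center (hε : 0 < ε) (hb : ∀ i, b i ≠ b' i) (hj : j ∉ T₁) (a : Ω j) :
    Real.exp (starEnergy ε b j T₁ T₂ j (Function.update (A.piecewise b b') j a)) =
      if a = b j then ε ^ (T₁ ∩ A).card else 1 := by
  have h1 : ∀ t ∈ T₁, (Function.update (A.piecewise b b') j a t = b t ↔ t ∈ A) := by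
    intro t ht
    rw [Function.update_of_ne (ne_of_mem_of_not_mem ht hj)]
    by_cases htA : t ∈ A
    · simp [htA]
    · simp [htA, (hb t).symm]
  simp only [starEnergy, if_true, Finset.sum_apply, Function.update_self]
  split_ifs with ha
  · simp only [ha, true_and]
    rw [Finset.sum_congr rfl fun t ht => by rw [← ha, if_congr (h1 t ht) rfl rfl],
      ← Finset.sum_filter, Finset.sum_const, Finset.filter_mem_eq_inter, nsmul_eq_mul,
      Real.exp_nat_mul, Real.exp_log hε]
  · simp [ha]

variable [∀ i, Fintype (Ω i)]

open Classical in
theorem gibbsKernel_starEnergy_center (hε : 0 < ε) (hb : ∀ i, b i ≠ b' i) (hj : j ∉ T₁)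
    (a : Ω j) :
    gibbsKernel (starEnergy ε b j T₁ T₂ j) j (Function.update (A.piecewise b b') j a) =
      (if a = b j then ε ^ (T₁ ∩ A).card else 1) /
        (ε ^ (T₁ ∩ A).card + (Fintype.card (Ω j) - 1)) := by
  simp only [gibbsKernel, Function.update_idem, exp_starEnergy_center hε hb hj,
    sum_ite_eq_add_mul, mul_one]

open Classical in
theorem gibbsKernel_starEnergy_leaf (hε : 0 < ε) (hb : ∀ i, b i ≠ b' i) {t : V} (ht : t ∈ T₂)
    (htj : t ≠ j) (a : Ω j) :
    gibbsKernel (starEnergy ε b j T₁ T₂ t) t (Function.update (A.piecewise b b') j a) =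
      if a = b j then (if t ∈ A then ε else 1) / (ε + (Fintype.card (Ω t) - 1))
      else 1 / Fintype.card (Ω t) := by
  have h1 : Function.update (A.piecewise b b') j a t = b t ↔ t ∈ A := by
    rw [Function.update_of_ne htj]
    by_cases htA : t ∈ A
    · simp [htA]
    · simp [htA, (hb t).symm]
  simp only [gibbsKernel, starEnergy, if_neg htj, if_pos ht, Function.update_self,
    Function.update_of_ne htj.symm, h1, apply_ite Real.exp, Real.exp_log hε,
    Real.exp_zero]
  split_ifs with ha htA <;> simp_all [sum_ite_eq_add_mul]

end Values

variable [∀ i, Fintype (Ω i)]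

/-- The law of the leaves of a star, up to a constant factor, after summing over the centre: the
leaves in `A` are in the state `b`, the others are not. -/
noncomputable def starMarginal (Ω : V → Type*) [∀ i, Fintype (Ω i)] (j : V) (T₁ T₂ : Finset V)
    (ε : ℝ) (A : Finset V) : ℝ :=
  ε ^ (T₁ ∩ A).card / (ε ^ (T₁ ∩ A).card + (Fintype.card (Ω j) - 1)) *
      ∏ t ∈ T₂, (if t ∈ A then ε else 1) / (ε + (Fintype.card (Ω t) - 1)) +
    (Fintype.card (Ω j) - 1) * (1 / (ε ^ (T₁ ∩ A).card + (Fintype.card (Ω j) - 1)) *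
      ∏ t ∈ T₂, 1 / (Fintype.card (Ω t) : ℝ))

theorem starMarginal_pos [∀ i, Nontrivial (Ω i)] (hε : 0 ≤ ε) (A : Finset V) :
    0 < starMarginal Ω j T₁ T₂ ε A := by
  have hm := fun i => one_le_card_sub_one (Ω i)
  have hpow : 0 ≤ ε ^ (T₁ ∩ A).card := by positivity
  have hmj := hm j
  unfold starMarginal
  refine add_pos_of_nonneg_of_pos ?_ ?_
  · refine mul_nonneg (div_nonneg hpow (by linarith)) (Finset.prod_nonneg fun t _ => ?_)
    have := hm t
    exact div_nonneg (by split_ifs <;> linarith) (by linarith)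
  · refine mul_pos (by linarith) (mul_pos (div_pos one_pos (by linarith))
      (Finset.prod_pos fun t _ => ?_))
    have := hm t
    exact div_pos one_pos (by linarith)

theorem continuousAt_starMarginal [∀ i, Nontrivial (Ω i)] (A : Finset V) :
    ContinuousAt (fun ε => starMarginal Ω j T₁ T₂ ε A) 0 := by
  have hm := fun i => one_le_card_sub_one (Ω i)
  have hpow : (0 : ℝ) ≤ 0 ^ (T₁ ∩ A).card := by positivity
  have hmj := hm j
  unfold starMarginal
  refine ContinuousAt.add (ContinuousAt.mul (ContinuousAt.div (by fun_prop) (by fun_prop)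
    (by linarith)) (tendsto_finsetProd _ fun t _ => ?_)) (continuousAt_const.mul
    (ContinuousAt.mul (ContinuousAt.div (by fun_prop) (by fun_prop) (by linarith))
      continuousAt_const))
  have := hm t
  refine ContinuousAt.div ?_ (by fun_prop) (by linarith)
  split_ifs <;> fun_prop

/-- In the limit `ε → 0` of a star with an outgoing arm, the leaves are dependent in full order. -/
theorem altSum_log_starMarginal_zero_ne [∀ i, Nontrivial (Ω i)] (h₂ : T₂.Nonempty)
    (hT : Disjoint T₁ T₂) :
    altSum (T₁ ∪ T₂) (fun A => Real.log (starMarginal Ω j T₁ T₂ 0 A)) ≠ 0 := by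
  have hm := fun i => one_le_card_sub_one (Ω i)
  obtain ⟨s, hs⟩ := h₂
  set m : ℝ := Fintype.card (Ω j) - 1 with hmdef
  have hmj : 1 ≤ m := hm j
  set C : ℝ := ∏ t ∈ T₂, 1 / (Fintype.card (Ω t) : ℝ) with hC
  set D : ℝ := ∏ t ∈ T₂, 1 / ((Fintype.card (Ω t) : ℝ) - 1) with hD
  have hCpos : 0 < C := Finset.prod_pos fun t _ => div_pos one_pos (by have := hm t; linarith)
  have hDpos : 0 < D := Finset.prod_pos fun t _ => div_pos one_pos (by have := hm t; linarith)
  rw [altSum_eq_sub (ψ := fun A => Real.log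
    (m * (1 / (0 ^ (T₁ ∩ A).card + m) * C)))]
  · have h1 : starMarginal Ω j T₁ T₂ 0 ∅ = 1 / (1 + m) * D + m * (1 / (1 + m) * C) := by
      simp [starMarginal, hmdef, hC, hD]
    simp only [h1, Finset.inter_empty, Finset.card_empty, pow_zero]
    refine sub_ne_zero.2 (Real.log_lt_log (by positivity) ?_).ne'
    have : 0 < 1 / (1 + m) * D := by positivity
    linarith
  · intro A hA hne
    congr 1
    unfold starMarginal
    rw [← hmdef, ← hC, add_eq_right]
    by_cases h : (T₁ ∩ A).Nonempty
    · simp [h.card_pos.ne']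
    · obtain ⟨t, ht⟩ := hne
      have ht2 : t ∈ T₂ := (Finset.mem_union.1 (hA ht)).resolve_left fun h' =>
        h ⟨t, Finset.mem_inter.2 ⟨h', ht⟩⟩
      rw [Finset.prod_eq_zero ht2 (by simp [ht]), mul_zero]
  · refine altSum_eq_zero (t := s) (Finset.mem_union_right _ hs) fun A _ => ?_
    rw [Finset.inter_insert_of_notMem (Finset.disjoint_right.1 hT hs)]

variable [Fintype V]

/-- The Markov distribution with the energies of a star. -/
theorem HDAG.exists_isMarkov_star [∀ i, Nonempty (Ω i)] (H : HDAG V) (ε : ℝ) (b : ∀ i, Ω i)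
    (h₁ : ∀ t ∈ T₁, H.IsParent t j) (h₂ : ∀ t ∈ T₂, H.IsParent j t) :
    ∃ p : PosDist Ω, p.IsMarkov H ∧ ∀ A : Finset V, j ∈ A → T₁ ⊆ A → ∀ x,
      p.marginal A x = ∏ i ∈ A, gibbsKernel (starEnergy ε b j T₁ T₂ i) i x := by
  classical
  obtain ⟨p, hp, hmarg⟩ := H.exists_isMarkov (Ω := Ω) (e := starEnergy ε b j T₁ T₂)
    (P := fun i => if i = j then T₁ else if i ∈ T₂ then {j} else ∅)
    (fun i => by
      unfold starEnergy
      split_ifs with hj h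
      · subst hj
        exact Submodule.sum_mem _ fun t ht => functionsOn_le_energySpace (h₁ t ht)
          (pair_mem_functionsOn _ b (by simp) (by simp))
      · exact functionsOn_le_energySpace (h₂ i h) (pair_mem_functionsOn _ b (by simp) (by simp))
      · exact zero_mem _)
    (fun i => by
      split_ifs with hj h
      · subst hj; exact fun t ht => mem_parents.2 (h₁ t ht)
      · simpa [mem_parents] using h₂ i h
      · simp)
    (fun i => by
      unfold starEnergy
      split_ifs with hj h
      · subst hj
        exact Submodule.sum_mem _ fun t ht =>
          pair_mem_functionsOn _ b (by simp) (by simp [ht])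
      · exact pair_mem_functionsOn _ b (by simp) (by simp)
      · exact zero_mem _)
  refine ⟨p, hp, fun A hj hT => hmarg A fun i _ => ?_⟩
  split_ifs
  · exact hT
  · simpa using hj
  · simp

/-- Conditioning on a common child `j` of the variables in `T` makes them dependent in full order,
even if `j` has only pair interactions with its parents: the log-normalizer of `j` contains an
energy of full order. -/
theorem HDAG.not_induces_insert_of_parents [∀ i, Nontrivial (Ω i)] {H : HDAG V} {T Z : Finset V}
    (hT : 2 ≤ T.card) (hTZ : Disjoint T Z) (hj : ∀ t ∈ T, H.IsParent t j) :
    ¬ H.Induces Ω T (insert j Z) := by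
  classical
  intro hind
  choose b b' hb using fun i => exists_pair_ne (Ω i)
  have hjT : j ∉ T := fun h => (hj j h).ne rfl
  have hTZ' : Disjoint T (insert j Z) := Finset.disjoint_insert_right.2 ⟨hjT, hTZ⟩
  have hTne : T.Nonempty := Finset.card_pos.1 (by omega)
  have hm := one_le_card_sub_one (Ω j)
  set m : ℝ := Fintype.card (Ω j) - 1 with hmdef
  have hpair : ∀ t, ¬ T ⊆ ({j, t} : Finset V) := fun t h => by
    have h' : T ⊆ {t} := (Finset.subset_insert_iff_of_notMem hjT).1 h
    have := Finset.card_le_card h'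
    simp at this
    omega
  have key : ∀ ε, 0 < ε → altSum T (fun A => Real.log (ε ^ A.card + m)) = 0 := by
    intro ε hε
    obtain ⟨p, hp, hmarg⟩ := H.exists_isMarkov_star (Ω := Ω) (T₂ := ∅) ε b hj (by simp)
    have hmi := (PosDist.multiIndep_iff hTne hTZ').1 (hind p hp)
    set g := starEnergy ε b j T ∅ j with hg
    have heq : (fun x => Real.log (p.marginal (T ∪ insert j Z) x)) =
        g - (fun x => Real.log (∑ a, Real.exp (g (Function.update x j a)))) +
          ∑ i ∈ (T ∪ insert j Z).erase j,
            fun x => Real.log (gibbsKernel (0 : (∀ i, Ω i) → ℝ) i x) := by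
      ext x
      rw [hmarg _ (by simp) Finset.subset_union_left,
        Real.log_prod fun i _ => (gibbsKernel_pos _ i x).ne',
        ← Finset.add_sum_erase _ _ (show j ∈ T ∪ insert j Z by simp)]
      simp only [← hg, log_gibbsKernel g j x, Pi.add_apply, Pi.sub_apply, Finset.sum_apply]
      congr 1
      refine Finset.sum_congr rfl fun i hi => ?_
      simp [starEnergy, Finset.ne_of_mem_erase hi]
    have h1 : g ∈ lowOrder Ω T (insert j Z) := by
      simp only [hg, starEnergy, if_true]
      refine Submodule.sum_mem _ fun t ht => functionsOn_le_lowOrder (U := {j, t}) ?_ (hpair t)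
        (pair_mem_functionsOn _ b (by simp) (by simp))
      intro i hi
      simp at hi
      rcases hi with rfl | rfl <;> simp [*]
    have h2 : (∑ i ∈ (T ∪ insert j Z).erase j,
        fun x => Real.log (gibbsKernel (0 : (∀ i, Ω i) → ℝ) i x)) ∈ lowOrder Ω T (insert j Z) :=
      Submodule.sum_mem _ fun i _ => functionsOn_le_lowOrder (Finset.empty_subset _)
        (fun h => hTne.ne_empty (Finset.subset_empty.1 h)) (log_gibbsKernel_zero_mem i ∅)
    have h3 : (fun x => Real.log (∑ a, Real.exp (g (Function.update x j a)))) ∈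
        lowOrder Ω T (insert j Z) := by
      rw [heq] at hmi
      have := sub_mem h1 (sub_mem hmi h2)
      rwa [add_sub_cancel_right, sub_sub_cancel] at this
    have h4 := altSum_eq_zero_of_mem_lowOrder hTZ' h3 b b'
    rw [← h4]
    refine Finset.sum_congr rfl fun A hA => ?_
    simp only [hg, exp_starEnergy_center hε hb hjT, sum_ite_eq_add_mul, mul_one,
      Finset.inter_eq_right.2 (Finset.mem_powerset.1 hA)]
    rw [← hmdef]
  have hcont : ContinuousAt (fun ε => altSum T (fun A => Real.log (ε ^ A.card + m))) 0 := by
    unfold altSum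
    refine tendsto_finsetSum _ fun A _ => ?_
    refine ContinuousAt.mul continuousAt_const (ContinuousAt.log (by fun_prop) ?_)
    have : (0 : ℝ) ≤ 0 ^ A.card := by positivity
    linarith
  have h0 := eq_zero_of_continuousAt_of_pos hcont key
  obtain ⟨t, ht⟩ := hTne
  -- In the limit only the empty set is special.
  rw [altSum_eq_sub (ψ := fun _ => Real.log m)
    (fun A _ hA => by simp [hA.card_pos.ne']) (altSum_eq_zero ht fun _ _ => rfl)] at h0
  have := Real.log_lt_log (by linarith) (show m < 1 + m by linarith)
  simp at h0
  linarith

/-- If `j` is adjacent to all variables in `T` and is a parent of one of them, then these are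
inseparable without conditioning on `j`. -/
theorem HDAG.not_induces_of_child [∀ i, Nontrivial (Ω i)] {H : HDAG V} {T Z : Finset V}
    (hjT : j ∉ T) (hjZ : j ∉ Z) (hTZ : Disjoint T Z)
    (hadj : ∀ t ∈ T, H.IsParent t j ∨ H.IsParent j t) (hch : ∃ t ∈ T, H.IsParent j t) :
    ¬ H.Induces Ω T Z := by
  classical
  intro hind
  choose b b' hb using fun i => exists_pair_ne (Ω i)
  obtain ⟨s, hs, hjs⟩ := hch
  set T₁ := T.filter (fun t => H.IsParent t j) with hT₁
  set T₂ := T.filter (fun t => H.IsParent j t) with hT₂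
  have hT : T₁ ∪ T₂ = T := by
    rw [hT₁, hT₂, ← Finset.filter_or]
    exact Finset.filter_true_of_mem hadj
  have hdisj : Disjoint T₁ T₂ := by
    rw [Finset.disjoint_left]
    intro t h1 h2
    exact (Finset.mem_filter.1 h1).2.asymm (Finset.mem_filter.1 h2).2
  have hjT₁ : j ∉ T₁ := fun h => hjT (Finset.mem_filter.1 h).1
  have hne : T₂.Nonempty := ⟨s, Finset.mem_filter.2 ⟨hs, hjs⟩⟩
  have hjTZ : j ∉ T ∪ Z := by simp [hjT, hjZ]
  have hT₂Z : T₂ ⊆ T ∪ Z := (Finset.filter_subset _ _).trans Finset.subset_union_left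
  have key : ∀ ε, 0 < ε → altSum T (fun A => Real.log (starMarginal Ω j T₁ T₂ ε A)) = 0 := by
    intro ε hε
    obtain ⟨p, hp, hmarg⟩ := H.exists_isMarkov_star (Ω := Ω) (j := j) (T₁ := T₁) (T₂ := T₂) ε b
      (fun t ht => (Finset.mem_filter.1 ht).2) (fun t ht => (Finset.mem_filter.1 ht).2)
    have hmi := altSum_eq_zero_of_mem_lowOrder hTZ
      ((PosDist.multiIndep_iff ⟨s, hs⟩ hTZ).1 (hind p hp)) b b'
    set K : ℝ := ∏ i ∈ (T ∪ Z) \ T₂, 1 / (Fintype.card (Ω i) : ℝ) with hK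
    have hKpos : 0 < K := Finset.prod_pos fun i _ => by
      have := one_le_card_sub_one (Ω i)
      exact div_pos one_pos (by linarith)
    have hval : ∀ A, p.marginal (T ∪ Z) (A.piecewise b b') = K * starMarginal Ω j T₁ T₂ ε A := by
      intro A
      rw [PosDist.marginal_eq, marginalSum_eq_sum_update _ hjTZ]
      have h1 : ∀ a, marginalSum p.mass (insert j (T ∪ Z))
          (Function.update (A.piecewise b b') j a) =
          K * if a = b j then
            ε ^ (T₁ ∩ A).card / (ε ^ (T₁ ∩ A).card + (Fintype.card (Ω j) - 1)) *
              ∏ t ∈ T₂, (if t ∈ A then ε else 1) / (ε + (Fintype.card (Ω t) - 1))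
          else 1 / (ε ^ (T₁ ∩ A).card + (Fintype.card (Ω j) - 1)) *
            ∏ t ∈ T₂, 1 / (Fintype.card (Ω t) : ℝ) := by
        intro a
        rw [← PosDist.marginal_eq, hmarg _ (by simp) ((Finset.filter_subset _ _).trans
          (Finset.subset_union_left.trans (Finset.subset_insert _ _))), Finset.prod_insert hjTZ,
          gibbsKernel_starEnergy_center hε hb hjT₁, ← Finset.prod_sdiff hT₂Z]
        have h2 : ∀ i ∈ (T ∪ Z) \ T₂, gibbsKernel (starEnergy ε b j T₁ T₂ i) i
            (Function.update (A.piecewise b b') j a) = 1 / (Fintype.card (Ω i) : ℝ) := by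
          intro i hi
          rw [Finset.mem_sdiff] at hi
          have hij : i ≠ j := ne_of_mem_of_not_mem hi.1 hjTZ
          rw [← gibbsKernel_zero i (Function.update (A.piecewise b b') j a)]
          simp [starEnergy, hij, hi.2]
        have h3 : ∀ t ∈ T₂, gibbsKernel (starEnergy ε b j T₁ T₂ t) t
            (Function.update (A.piecewise b b') j a) = _ := fun t ht =>
          gibbsKernel_starEnergy_leaf hε hb ht (ne_of_mem_of_not_mem (hT₂Z ht) hjTZ) a
        rw [Finset.prod_congr rfl h2, Finset.prod_congr rfl h3, ← hK, mul_left_comm]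
        split_ifs <;> rfl
      simp only [h1]
      rw [← Finset.mul_sum, sum_ite_eq_add_mul, starMarginal]
    have hlog : ∀ A, Real.log (starMarginal Ω j T₁ T₂ ε A) =
        Real.log (p.marginal (T ∪ Z) (A.piecewise b b')) - Real.log K := by
      intro A
      rw [hval, Real.log_mul hKpos.ne' (starMarginal_pos hε.le A).ne']
      ring
    simp only [hlog]
    rw [altSum_sub, hmi, altSum_eq_zero hs fun _ _ => rfl, sub_zero]
  refine altSum_log_starMarginal_zero_ne (Ω := Ω) (j := j) hne hdisj ?_
  rw [hT]
  refine eq_zero_of_continuousAt_of_pos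
    (h := fun ε => altSum T (fun A => Real.log (starMarginal Ω j T₁ T₂ ε A))) ?_ key
  unfold altSum
  refine tendsto_finsetSum _ fun A _ => ?_
  exact continuousAt_const.mul
    ((continuousAt_starMarginal A).log (starMarginal_pos le_rfl A).ne')

end Star

/-! ### Hyper Markov equivalence -/

section Equivalence

variable {V : Type*} [Fintype V] [DecidableEq V] {Ω : V → Type*} [∀ i, Fintype (Ω i)]
  [∀ i, Nontrivial (Ω i)]

variable (Ω) in
theorem HDAG.mem_body_iff_forall_not_induces (H : HDAG V) {T : Finset V} (hT : T.Nonempty) :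
    T ∈ H.body ↔ ∀ Z, Disjoint T Z → ¬ H.Induces Ω T Z := by
  refine ⟨fun h Z hTZ => not_induces_of_mem_body h hTZ, fun h => ?_⟩
  by_contra hTH
  obtain ⟨Z, hTZ, hind, -⟩ := H.exists_induces_of_notMem_body (Ω := Ω) hT hTH
  exact h Z hTZ hind

variable (Ω) in
theorem HDAG.isUnshieldedMultiCollider_iff_induces (H : HDAG V) {T : Finset V} {j : V}
    (hT : 2 ≤ T.card) (hj : j ∉ T) :
    H.IsUnshieldedMultiCollider T j ↔
      (∀ t ∈ T, ∀ Z, Disjoint {t, j} Z → ¬ H.Induces Ω {t, j} Z) ∧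
        ∃ Z, Disjoint T Z ∧ j ∉ Z ∧ H.Induces Ω T Z ∧ ¬ H.Induces Ω T (insert j Z) := by
  have hTne : T.Nonempty := Finset.card_pos.1 (by omega)
  have hpair : ∀ t ∈ T, (∀ Z, Disjoint {t, j} Z → ¬ H.Induces Ω {t, j} Z) ↔
      (H.IsParent t j ∨ H.IsParent j t) := fun t ht => by
    rw [← mem_body_iff_forall_not_induces Ω H (by simp),
      pair_mem_body_iff (ne_of_mem_of_not_mem ht hj)]
  rw [isUnshieldedMultiCollider_iff, forall₂_congr hpair]
  constructor
  · rintro ⟨-, hpar, hb⟩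
    obtain ⟨Z, hTZ, hind, hZ⟩ := H.exists_induces_of_notMem_body (Ω := Ω) hTne hb
    exact ⟨fun t ht => Or.inl (hpar t ht), Z, hTZ, hZ j hpar, hind,
      not_induces_insert_of_parents hT hTZ hpar⟩
  · rintro ⟨hadj, Z, hTZ, hjZ, hind, -⟩
    refine ⟨hT, fun t ht => (hadj t ht).resolve_right fun h => ?_, fun hb => ?_⟩
    · exact not_induces_of_child hj hjZ hTZ hadj ⟨t, ht, h⟩ hind
    · exact not_induces_of_mem_body hb hTZ hind

theorem HDAG.HyperMarkovEquiv.sameBodyAndColliders {H₁ H₂ : HDAG V}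
    (h : HDAG.HyperMarkovEquiv Ω H₁ H₂) : HDAG.SameBodyAndColliders H₁ H₂ := by
  refine ⟨?_, fun S j => ?_⟩
  · ext T
    rcases Nat.lt_or_ge T.card 2 with hT | hT
    · rcases T.eq_empty_or_nonempty with rfl | hne
      · simp [mem_body_iff]
      · obtain ⟨a, rfl⟩ := Finset.card_eq_one.1 (by have := hne.card_pos; omega : T.card = 1)
        simp [singleton_mem_body]
    · have hne : T.Nonempty := Finset.card_pos.1 (by omega)
      rw [mem_body_iff_forall_not_induces Ω H₁ hne, mem_body_iff_forall_not_induces Ω H₂ hne]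
      exact forall₂_congr fun Z hZ => not_congr (h T Z hT hZ)
  · by_cases hS : 2 ≤ S.card ∧ j ∉ S
    · obtain ⟨hS, hj⟩ := hS
      rw [isUnshieldedMultiCollider_iff_induces Ω H₁ hS hj,
        isUnshieldedMultiCollider_iff_induces Ω H₂ hS hj]
      refine and_congr (forall₂_congr fun t ht => forall₂_congr fun Z hZ => not_congr (h _ _ ?_ hZ))
        (exists_congr fun Z => and_congr_right fun hZ => and_congr_right fun _ =>
          and_congr (h _ _ hS hZ) (not_congr (h _ _ hS ?_)))
      · rw [Finset.card_pair (ne_of_mem_of_not_mem ht hj)]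
      · exact Finset.disjoint_insert_right.2 ⟨hj, hZ⟩
    · have hnot : ∀ H : HDAG V, ¬ H.IsUnshieldedMultiCollider S j := fun H hc =>
        hS ⟨hc.1.1, fun hj => (hc.1.2 j hj).ne rfl⟩
      simp [hnot]

end Equivalence

theorem theorem1 {V : Type*} [Fintype V] [DecidableEq V] (Ω : V → Type*)
    [∀ i, Fintype (Ω i)] [∀ i, Nontrivial (Ω i)] :
    -- Two HDAGs induce the same conditional multi-independences iff they have the same body and
    -- the same unshielded multi-colliders.
    (∀ H₁ H₂ : HDAG V,
      HDAG.HyperMarkovEquiv Ω H₁ H₂ ↔ HDAG.SameBodyAndColliders H₁ H₂) ∧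
    -- The HDAGs to which a given distribution is Markov and faithful form exactly one such class.
    (∀ (p : PosDist Ω) (H₁ : HDAG V), p.IsMarkov H₁ → p.IsFaithful H₁ →
      ∀ H₂ : HDAG V,
        (p.IsMarkov H₂ ∧ p.IsFaithful H₂) ↔ HDAG.SameBodyAndColliders H₁ H₂) ∧
    -- The class is read off from the conditional multi-independences of the distribution.
    (∀ (p : PosDist Ω) (H : HDAG V), p.IsMarkov H → p.IsFaithful H →
      (∀ T : Finset V, 2 ≤ T.card → (T ∈ H.body ↔ p.Inseparable T)) ∧
      (∀ (T : Finset V) (j : V), 2 ≤ T.card → j ∉ T →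
        (H.IsUnshieldedMultiCollider T j ↔
          (∀ t ∈ T, p.Inseparable {t, j}) ∧
          ∃ Z : Finset V, Disjoint T Z ∧ j ∉ Z ∧
            p.MultiIndep T Z ∧ ¬ p.MultiIndep T (insert j Z)))) := by
  have hfaith : ∀ {p : PosDist Ω} {H : HDAG V}, p.IsMarkov H → p.IsFaithful H →
      ∀ T Z : Finset V, 2 ≤ T.card → Disjoint T Z → (p.MultiIndep T Z ↔ H.Induces Ω T Z) :=
    fun hp hf T Z hT hTZ => ⟨hf T Z hT hTZ, fun h => h _ hp⟩
  refine ⟨fun H₁ H₂ => ⟨fun h => h.sameBodyAndColliders, fun h T Z _ _ => h.induces_iff T Z⟩,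
    fun p H₁ hp hf H₂ => ⟨fun h => ?_, fun h => ⟨h.isMarkov hp, fun T Z hT hTZ hmi => ?_⟩⟩,
    fun p H hp hf => ⟨fun T hT => ?_, fun T j hT hj => ?_⟩⟩
  · refine HDAG.HyperMarkovEquiv.sameBodyAndColliders (Ω := Ω) fun T Z hT hTZ => ?_
    rw [← hfaith hp hf T Z hT hTZ, ← hfaith h.1 h.2 T Z hT hTZ]
  · exact (h.induces_iff T Z).1 (hf T Z hT hTZ hmi)
  · rw [H.mem_body_iff_forall_not_induces Ω (Finset.card_pos.1 (by omega))]
    exact forall₂_congr fun Z hZ => not_congr (hfaith hp hf T Z hT hZ).symm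
  · rw [H.isUnshieldedMultiCollider_iff_induces Ω hT hj]
    refine and_congr (forall₂_congr fun t ht => forall₂_congr fun Z hZ =>
        not_congr (hfaith hp hf _ _ ?_ hZ).symm)
      (exists_congr fun Z => and_congr_right fun hZ => and_congr_right fun _ =>
        and_congr (hfaith hp hf _ _ hT hZ).symm (not_congr (hfaith hp hf _ _ hT ?_).symm))
    · rw [Finset.card_pair (ne_of_mem_of_not_mem ht hj)]
    · exact Finset.disjoint_insert_right.2 ⟨hj, hZ⟩
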